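/- **Setting.** Let $\Sigma$ be a terminal alphabet with an end marker $\dashv\,\in\Sigma$. Context-free grammars $(\Sigma,\mathrm N,P,S)$ have $\dashv$ on no right side of a production, and $\Rightarrow$ denotes *rightmost* derivation. A *sentential form* is a string $\zeta$ with $S\dashv\;\Rightarrow^*\zeta$. The *augmented grammar* has an additional start symbol $S'$ and production $S'\to S$. The grammar is *LR(1)* if $S'\Rightarrow^*\alpha Aw\Rightarrow\alpha\beta w$, $S'\Rightarrow^*\gamma Bx\Rightarrow\alpha\beta y$ and $\mathrm{FIRST}(w)=\mathrm{FIRST}(y)$ imply $\alpha=\gamma$, $A=B$, $x=y$. A *viable prefix* is an initial segment of some $\alpha\beta$ with $S'\Rightarrow^*\alpha Aw\Rightarrow\alpha\beta w$; it is *followed by* $a\in\Sigma$ if, when called $\gamma$, some $\gamma ax$ with $x\in\Sigma^*$ is a sentential form. Fix a coding of grammars and of grammar transformations by strings in a context-free language $L_T$. A *$\Delta$-machine* $M$ is a Turing machine with three semi-infinite tapes that halts on all inputs $(y,u,g)$, $g\in L_T$, with a string of $L_T$ on its third tape; its *output* is $(w,\Delta)$ if then $w$ is on the second tape and the code of the transformation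 $\Delta$ on the third. A *TLR grammar* $G=(\Sigma,\mathrm N,P,S,T,M)$ consists of an LR(1) grammar $(\Sigma,\mathrm N,P,S)$ in which every nonterminal that can be reached from $S$ derives a terminal string, a set $T\subseteq P$ of *transformative* productions, and a $\Delta$-machine $M$. A *grammar transformation* for $G$ is $\Delta=(N,P_+,P_-)$ with $P\cap P_+=\emptyset$, $P_-\subseteq P$, and $\Delta G=(\Sigma,\mathrm N\cup N,(P\cup P_+)\setminus P_-,S,T,M)$. *Validity.* Let $\alpha B$ ($B$ a nonterminal) be a viable prefix followed by $a$, let $\alpha Bax$ be a sentential form, and consider the tree of a rightmost derivation $S\dashv\;\Rightarrow^*\alpha Bax$, whose interior nodes are labelled with productions, with root $S'\to S\dashv$. For an interior node $\mathsf P$ other than the root, with $n$ children, let $N(\mathsf P)=i$ if $\mathsf P$ is an ancestor of the leaf $a$ through its $i$-th child; $N(\mathsf P)=n+1$ if $\mathsf P$ is an ancestor of the leaf $B$ but not of $a$, or is an ancestor of neither and lies between $B$ and $a$; and $N(\mathsf P)=-1$ otherwise. Let $V(\pi)$ be the maximum of $N(\mathsf P)$ over the nodes labelled $\pi$ ($-1$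 if there are none). $\Delta$ is *valid* for $\alpha Ba$ in $G$ if it is the identity or if, for all such $x$ and every $\pi\in P$ with $V(\pi)\ne-1$, the grammar $\Delta G$ has a production with the same head and the same first $V(\pi)$ right-side symbols as $\pi$ (if $V(\pi)$ is at most the length of the right side of $\pi$), respectively the production $\pi$ itself (if $V(\pi)$ exceeds that length). *Language.* A configuration $(\alpha\cdot x,u,H)$ consists of the processed part $\alpha\in(\Sigma\cup\mathrm N)^*$, the unread input $x\in\Sigma^*$, the contents $u$ of the second tape, and a TLR grammar $H$ with the given $\Sigma,S,T,M$. There is a *valid semiparse* $(\alpha\cdot x,u,H)\rightarrowtail(\beta\cdot z,w,H')$ if either 1. $\beta=S$, $z=\epsilon$, $H'=H$, and $S\Rightarrow^*\alpha x$ in $H$ without transformative productions; or 2. $x=yz$, $\beta=\beta'B$, and $\beta'Bz\Rightarrow\beta'\gamma z\Rightarrow^*\alpha yz$ in $H$, where the first step uses a transformative production and the others do not; the output of $M$ on $(y,u,H)$ is $(w,\Delta)$ with $H'=\Delta H$; $\Delta$ is valid for $\beta b$ in $H$, where $b$ is the first symbol of $z\dashv$; and $\beta$ is a viable prefix followed by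 $b$ for $H'$. $L(G)$ is the set of $x$ such that a chain of at least one valid semiparse leads from $(\epsilon\cdot x,\epsilon,G)$ to some $(S\cdot\epsilon,w,G')$. *TLR Parsing Algorithm.* On input $x$ it runs the shift-reduce parser with the canonical LR(1) tables of the current grammar (initially $G$) on $x\dashv$, recording the string $w_\Delta$ of terminals shifted since the last transformation and the contents $z_\Delta$ of the second tape of $M$ (both initially $\epsilon$). It accepts when it reduces by $S'\to S$, and rejects at an error entry. When it reduces by $B\to\gamma\in T$, it pops $\gamma$, runs $M$ on $(w_\Delta,z_\Delta,\text{current grammar})$ to obtain a new $z_\Delta$ and a transformation $\Delta$, checks that $\Delta$ is valid for $\beta'Ba$ (where $\beta'$ is the remaining string of stack symbols and $a$ the lookahead) and that the transformed grammar is TLR, passes to the transformed grammar and its tables, rebuilds the stack for $\beta'$ by the new goto function, pushes $B$, and resets $w_\Delta$ to $\epsilon$. If $M$ outputs no transformation, a check fails, or goto is undefined, it rejects. Running $M$, the checks and the computation of tables count as single steps. **Theorem.** Let $G$ be a TLR grammar. The TLR Parsing Algorithm recognizes $L(G)$: for every $x\in(\Sigma\setminus\{\dashv\})^*$, it halts and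 accepts $x$ if and only if $x\in L(G)$, and it halts and rejects $x$ if and only if $x\notin L(G)$. In particular, it halts on every input. -/

import Mathlib

namespace TLR

/-! ### Context-free grammars, rightmost derivations and LR(1) grammars -/

/-- The data `(N, P, S)` of a context-free grammar whose terminal alphabet is `T`. The nonterminals
are drawn from a universe `ν`, since transformations may add new ones. -/
structure CFG (T ν : Type*) where
  nts : Finset ν
  rules : Finset (ContextFreeRule T ν)
  start : ν

section Grammars

variable {T ν : Type*}

/-- One step of a rightmost derivation with the productions `R`: the rightmost nonterminal is
replaced (everything to its right is terminal). -/
def RightStep (R : Set (ContextFreeRule T ν)) (u v : List (Symbol T ν)) : Prop :=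
  ∃ r ∈ R, ∃ (α : List (Symbol T ν)) (w : List T),
    u = α ++ Symbol.nonterminal r.input :: w.map Symbol.terminal ∧
    v = α ++ r.output ++ w.map Symbol.terminal

/-- Rightmost derivations of zero or more steps. -/
def RightDerives (R : Set (ContextFreeRule T ν)) :
    List (Symbol T ν) → List (Symbol T ν) → Prop :=
  Relation.ReflTransGen (RightStep R)

namespace CFG

/-- `N`, `P`, `S` form a context-free grammar: `S ∈ N`, `P ⊆ N × (Σ ∪ N)*`, and the end marker does
not appear on the right side of any production. -/
def WellFormed (eof : T) (G : CFG T ν) : Prop :=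
  G.start ∈ G.nts ∧
  ∀ r ∈ G.rules, r.input ∈ G.nts ∧
    (∀ A, Symbol.nonterminal A ∈ r.output → A ∈ G.nts) ∧ Symbol.terminal eof ∉ r.output

/-- The nonterminals that occur in some string derivable from the start symbol. -/
inductive Reachable (G : CFG T ν) : ν → Prop
  | start : Reachable G G.start
  | step (r : ContextFreeRule T ν) (B : ν) : r ∈ G.rules → Reachable G r.input →
      Symbol.nonterminal B ∈ r.output → Reachable G B

/-- Every nonterminal that can be reached from the start symbol derives some terminal string. -/
def Productive (G : CFG T ν) : Prop :=
  ∀ A, G.Reachable A →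
    ∃ w : List T, RightDerives ↑G.rules [Symbol.nonterminal A] (w.map Symbol.terminal)

/-- `FIRST(α)`: the terminals `b` such that `α` derives a terminal string `b x`. -/
def first (G : CFG T ν) (α : List (Symbol T ν)) : Set T :=
  {b | ∃ x : List T, RightDerives ↑G.rules α ((b :: x).map Symbol.terminal)}

/-- `G.LastStep α A β w` says that `S' ⇒* α A w ⇒ α β w` is a rightmost derivation in the augmented
grammar, which has the additional start symbol `S'` and the additional production `S' → S`. The new
nonterminal `S'` is `none`, the nonterminals of `G` are `some A`. -/
inductive LastStep (G : CFG T ν) :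
    List (Symbol T ν) → Option ν → List (Symbol T ν) → List T → Prop
  | augmented : LastStep G [] none [Symbol.nonterminal G.start] []
  | production (α : List (Symbol T ν)) (r : ContextFreeRule T ν) (w : List T) : r ∈ G.rules →
      RightDerives ↑G.rules [Symbol.nonterminal G.start]
        (α ++ Symbol.nonterminal r.input :: w.map Symbol.terminal) →
      LastStep G α (some r.input) r.output w

/-- `G` is LR(1): if `S' ⇒* α A w ⇒ α β w` and `S' ⇒* γ B x ⇒ γ δ x = α β y` in the augmented
grammar, and `FIRST(w) = FIRST(y)`, then `α = γ`, `A = B` and `x = y`. -/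
def IsLR1 (G : CFG T ν) : Prop :=
  ∀ (α β γ δ : List (Symbol T ν)) (A B : Option ν) (w x y : List T),
    G.LastStep α A β w → G.LastStep γ B δ x →
    γ ++ δ ++ x.map Symbol.terminal = α ++ β ++ y.map Symbol.terminal →
    G.first (w.map Symbol.terminal) = G.first (y.map Symbol.terminal) →
    α = γ ∧ A = B ∧ x = y

/-- Sentential forms, with the end marker: the strings `ζ` with `S ⊣ ⇒* ζ`. -/
def Sentential (eof : T) (G : CFG T ν) (ζ : List (Symbol T ν)) : Prop :=
  RightDerives ↑G.rules [Symbol.nonterminal G.start, Symbol.terminal eof] ζ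

/-- `γ` is a viable prefix: an initial segment of some `α β`, where `S' ⇒* α A w ⇒ α β w`. -/
def ViablePrefix (G : CFG T ν) (γ : List (Symbol T ν)) : Prop :=
  ∃ α A β w, G.LastStep α A β w ∧ γ <+: α ++ β

/-- `γ` is a viable prefix followed by the terminal `a`. -/
def ViableFollowedBy (eof : T) (G : CFG T ν) (γ : List (Symbol T ν)) (a : T) : Prop :=
  G.ViablePrefix γ ∧
    ∃ x : List T, G.Sentential eof (γ ++ Symbol.terminal a :: x.map Symbol.terminal)

end CFG

/-! ### Derivation trees and the conservation function -/

/-- Trees whose leaves are labelled with grammar symbols and whose interior nodes are labelled with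
productions. A node labelled with a production `A → ε` has no children. -/
inductive PTree (T ν : Type*)
  | leaf (X : Symbol T ν) : PTree T ν
  | node (r : ContextFreeRule T ν) (children : List (PTree T ν)) : PTree T ν

namespace PTree

/-- The grammar symbol at the root: the head of the production if the root is an interior node. -/
def root : PTree T ν → Symbol T ν
  | leaf X => X
  | node r _ => Symbol.nonterminal r.input

/-- The children of the root. -/
def children : PTree T ν → List (PTree T ν)
  | leaf _ => []
  | node _ cs => cs

mutual
/-- The yield of a tree: its leaves from left to right. -/
def frontier : PTree T ν → List (Symbol T ν)
  | leaf X => [X]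
  | node _ cs => frontierList cs
/-- The yield of a sequence of trees. -/
def frontierList : List (PTree T ν) → List (Symbol T ν)
  | [] => []
  | t :: ts => frontier t ++ frontierList ts
end

/-- Every interior node is labelled with a production of `R`, and its children spell the right side
of that production. -/
inductive IsDerivation (R : Set (ContextFreeRule T ν)) : PTree T ν → Prop
  | leaf (X : Symbol T ν) : IsDerivation R (leaf X)
  | node (r : ContextFreeRule T ν) (cs : List (PTree T ν)) : r ∈ R → cs.map root = r.output →
      (∀ c ∈ cs, IsDerivation R c) → IsDerivation R (node r cs)

/-- Nodes are addressed by the path leading to them (child numbers, counted from `0`). The sequence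
`ts` consists of the children of a virtual root, which has the empty path. -/
def nodeAt : List (PTree T ν) → List ℕ → Option (PTree T ν)
  | _, [] => none
  | ts, [i] => ts[i]?
  | ts, i :: j :: p =>
    match ts[i]? with
    | none => none
    | some t => nodeAt t.children (j :: p)

/-- The part of the yield of `ts` that lies strictly to the left of the node with the given path. -/
def yieldBefore : List (PTree T ν) → List ℕ → List (Symbol T ν)
  | _, [] => []
  | ts, i :: p =>
    frontierList (ts.take i) ++
      match ts[i]? with
      | none => []
      | some t => yieldBefore t.children p

end PTree

/-- `ts` is the derivation tree of the sentential form `α B a x`: its top level consists of a tree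
for `S` and of the end marker (the children of the root of `S' → S ⊣`), and `b` and `a'` are the
paths of the leaves that correspond to the displayed symbols `B` and `a`. As the derivation is
rightmost, no node to the left of `B` is expanded, so every interior node is an ancestor of `B` or
comes after `B`. -/
structure IsSententialTree (eof : T) (G : CFG T ν) (α : List (Symbol T ν)) (B : ν) (a : T)
    (x : List T) (ts : List (PTree T ν)) (b a' : List ℕ) : Prop where
  top : ∃ t : PTree T ν, t.root = Symbol.nonterminal G.start ∧ t.IsDerivation ↑G.rules ∧
    ts = [t, PTree.leaf (Symbol.terminal eof)]
  yield : PTree.frontierList ts =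
    α ++ Symbol.nonterminal B :: Symbol.terminal a :: x.map Symbol.terminal
  nodeB : PTree.nodeAt ts b = some (PTree.leaf (Symbol.nonterminal B))
  beforeB : PTree.yieldBefore ts b = α
  nodeA : PTree.nodeAt ts a' = some (PTree.leaf (Symbol.terminal a))
  beforeA : PTree.yieldBefore ts a' = α ++ [Symbol.nonterminal B]
  rightmost : ∀ p r cs, PTree.nodeAt ts p = some (PTree.node r cs) → p <+: b ∨ b < p

/-- The node with path `p` is a (proper) ancestor of the node with path `q`. -/
def IsAncestor (p q : List ℕ) : Prop := p <+: q ∧ p ≠ q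

open Classical in
/-- The number `N(P)` of an interior node `P` with path `p` and `n` children, where `b` and `a` are
the paths of the nodes `B` and `a`. An ancestor of `a` gets the number (counted from `1`) of its
child that lies above or at `a`; an ancestor of `B` but not of `a` gets `n + 1`; a node that is an
ancestor of neither and lies strictly between them gets `n + 1`; all others get `-1`. The total
order of the nodes of an ordered tree (ancestors first, then from left to right) is the
lexicographic order of the paths. All nodes have the virtual root as a common ancestor. -/
noncomputable def nodeNumber (b a p : List ℕ) (n : ℕ) : ℤ :=
  if IsAncestor p a then (a.getD p.length 0 : ℤ) + 1
  else if IsAncestor p b then (n : ℤ) + 1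
  else if b < p ∧ p < a then (n : ℤ) + 1
  else -1

/-- The conservation function `V(π)`: the maximum of `N(P)` over the nodes `P` labelled `π`, and
`-1` if there is no such node (note that always `N(P) ≥ -1`). -/
noncomputable def conservation (ts : List (PTree T ν)) (b a : List ℕ)
    (π : ContextFreeRule T ν) : ℤ :=
  sSup (insert (-1) {v | ∃ p cs, PTree.nodeAt ts p = some (PTree.node π cs) ∧
    v = nodeNumber b a p cs.length})

/-- `φ` has the conserved portion of `π`, where `v` is the value of the conservation function
at `π`: if `v ≤ n = |rhs π|` then `φ` has the same head and the same first `v` symbols on the right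
side; if `v = n + 1` then `φ = π`. -/
def ConservedBy (v : ℤ) (π φ : ContextFreeRule T ν) : Prop :=
  (v ≤ π.output.length ∧ π.input = φ.input ∧ π.output.take v.toNat <+: φ.output) ∨
  (v = π.output.length + 1 ∧ π = φ)

/-- The productions `P'` conserve the sentential form `α B a x` of `G`. -/
def Conserves (eof : T) (G : CFG T ν) (P' : Set (ContextFreeRule T ν))
    (α : List (Symbol T ν)) (B : ν) (a : T) (x : List T) : Prop :=
  ∀ ts b a', IsSententialTree eof G α B a x ts b a' →
    ∀ π ∈ G.rules, conservation ts b a' π ≠ -1 →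
      ∃ φ ∈ P', ConservedBy (conservation ts b a' π) π φ

/-! ### Grammar transformations -/

/-- A tuple `(N, P₊, P₋)`: nonterminals to add, productions to add, productions to remove. -/
structure Transformation (T ν : Type*) where
  addNts : Finset ν
  addRules : Finset (ContextFreeRule T ν)
  delRules : Finset (ContextFreeRule T ν)

namespace Transformation

/-- The conditions that make `Δ` a grammar transformation for `G`. -/
def IsFor (Δ : Transformation T ν) (G : CFG T ν) : Prop :=
  Disjoint G.rules Δ.addRules ∧ Δ.delRules ⊆ G.rules

open Classical in
/-- The transformed grammar `Δ G`. -/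
noncomputable def apply (Δ : Transformation T ν) (G : CFG T ν) : CFG T ν where
  nts := G.nts ∪ Δ.addNts
  rules := (G.rules ∪ Δ.addRules) \ Δ.delRules
  start := G.start

/-- `Δ` is valid for `α B a` in `G`, where `α B` is a viable prefix followed by `a`: the productions
of `Δ G` conserve every sentential form `α B a x` of `G`. The identity is always included. -/
def ValidFor (eof : T) (Δ : Transformation T ν) (G : CFG T ν) (α : List (Symbol T ν)) (B : ν)
    (a : T) : Prop :=
  Δ.IsFor G ∧ G.ViableFollowedBy eof (α ++ [Symbol.nonterminal B]) a ∧
    (Δ = ⟨∅, ∅, ∅⟩ ∨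
      ∀ x : List T,
        G.Sentential eof
          (α ++ Symbol.nonterminal B :: Symbol.terminal a :: x.map Symbol.terminal) →
        Conserves eof G ↑(Δ.apply G).rules α B a x)

end Transformation

/-- A way of writing grammars and grammar transformations as strings over a terminal alphabet `C`;
the strings all lie in the language of a context-free grammar. -/
structure Coding (T ν C : Type*) where
  language : ContextFreeGrammar C
  grammar : CFG T ν → List C
  transformation : Transformation T ν → List C
  grammar_injective : Function.Injective grammar
  transformation_injective : Function.Injective transformation
  grammar_mem : ∀ G, grammar G ∈ language.language
  transformation_mem : ∀ Δ, transformation Δ ∈ language.language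

end Grammars

/-! ### Turing machines with three semi-infinite tapes -/

/-- Head movements. -/
inductive Move
  | left
  | right
  | stay

/-- Move a head on a semi-infinite tape; a head on the first cell does not move to the left. -/
def Move.act : Move → ℕ → ℕ
  | left, i => i - 1
  | right, i => i + 1
  | stay, i => i

/-- A Turing machine with three tapes. The tape alphabets are `Option Γᵢ`, where `none` is the blank;
`δ` is undefined (`none`) where the machine halts. -/
structure TM3 (Q Γ₁ Γ₂ Γ₃ : Type*) where
  init : Q
  δ : Q → Option Γ₁ → Option Γ₂ → Option Γ₃ →
    Option (Q × (Option Γ₁ × Move) × (Option Γ₂ × Move) × (Option Γ₃ × Move))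

/-- A semi-infinite tape with a head. -/
structure Tape (Γ : Type*) where
  cells : ℕ → Option Γ
  head : ℕ

namespace Tape

variable {Γ : Type*}

/-- The tape that holds the string `l` and is blank otherwise. -/
def ofList (l : List Γ) : Tape Γ := ⟨fun i => l[i]?, 0⟩

/-- The scanned symbol. -/
def read (t : Tape Γ) : Option Γ := t.cells t.head

/-- Write a symbol and move the head. -/
def act (t : Tape Γ) (s : Option Γ × Move) : Tape Γ :=
  ⟨Function.update t.cells t.head s.1, s.2.act t.head⟩

/-- `l` is the contents of the tape up to the first blank cell. -/
def Holds (t : Tape Γ) (l : List Γ) : Prop := ∀ i ≤ l.length, t.cells i = l[i]?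

end Tape

namespace TM3

variable {Q Γ₁ Γ₂ Γ₃ : Type*}

/-- A machine configuration: state and tapes. -/
structure Config (Q Γ₁ Γ₂ Γ₃ : Type*) where
  state : Q
  tape₁ : Tape Γ₁
  tape₂ : Tape Γ₂
  tape₃ : Tape Γ₃

/-- One step of the machine; `none` if it halts. -/
def step (M : TM3 Q Γ₁ Γ₂ Γ₃) (c : Config Q Γ₁ Γ₂ Γ₃) : Option (Config Q Γ₁ Γ₂ Γ₃) :=
  (M.δ c.state c.tape₁.read c.tape₂.read c.tape₃.read).map fun m =>
    ⟨m.1, c.tape₁.act m.2.1, c.tape₂.act m.2.2.1, c.tape₃.act m.2.2.2⟩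

/-- Started with `y`, `u`, `g` on its tapes, the machine halts in the configuration `c`. -/
def HaltsAt (M : TM3 Q Γ₁ Γ₂ Γ₃) (y : List Γ₁) (u : List Γ₂) (g : List Γ₃)
    (c : Config Q Γ₁ Γ₂ Γ₃) : Prop :=
  Relation.ReflTransGen (fun c₁ c₂ => M.step c₁ = some c₂)
    ⟨M.init, Tape.ofList y, Tape.ofList u, Tape.ofList g⟩ c ∧ M.step c = none

end TM3

/-- A `Δ`-machine: a Turing machine with three tapes whose alphabets contain `T`, `T` and `C`,
respectively, which halts on every input `(y, u, g)` with `g` in the language of codes, and then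
has a string of that language on its third tape. -/
structure DeltaMachine {T ν C : Type*} (E : Coding T ν C) where
  Q : Type
  Γ₁ : Type
  Γ₂ : Type
  Γ₃ : Type
  finite_Q : Finite Q
  finite_Γ₁ : Finite Γ₁
  finite_Γ₂ : Finite Γ₂
  finite_Γ₃ : Finite Γ₃
  ι₁ : T ↪ Γ₁
  ι₂ : T ↪ Γ₂
  ι₃ : C ↪ Γ₃
  machine : TM3 Q Γ₁ Γ₂ Γ₃
  halts : ∀ (y : List T) (u : List Γ₂), ∀ g ∈ E.language.language,
    ∃ c, machine.HaltsAt (y.map ι₁) u (g.map ι₃) c ∧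
      ∃ z ∈ E.language.language, c.tape₃.Holds (z.map ι₃)

section Languages

variable {T ν C : Type*} {E : Coding T ν C}

/-- The output of `M` with input `(y, u, G)` is `(w, Δ)`: after halting, the second tape holds `w`
and the third tape holds the code of `Δ`. -/
def DeltaMachine.Outputs (M : DeltaMachine E) (y : List T) (u : List M.Γ₂) (G : CFG T ν)
    (w : List M.Γ₂) (Δ : Transformation T ν) : Prop :=
  ∃ c, M.machine.HaltsAt (y.map M.ι₁) u ((E.grammar G).map M.ι₃) c ∧
    c.tape₂.Holds w ∧ c.tape₃.Holds ((E.transformation Δ).map M.ι₃)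

/-! ### Transformative grammars and the languages they generate -/

/-- The data `(Σ, N, P, S, T, M)` of a transformative context-free grammar. -/
structure Grammar (E : Coding T ν C) where
  cfg : CFG T ν
  trans : Finset (ContextFreeRule T ν)
  M : DeltaMachine E

namespace Grammar

/-- The grammar with the same `Σ`, `S`, `T`, `M` and with `N`, `P` taken from `H`. -/
def withCFG (G : Grammar E) (H : CFG T ν) : Grammar E := { G with cfg := H }

/-- `G` is a TLR grammar: `(Σ, N, P, S)` is an LR(1) context-free grammar in which the nonterminals
that can be reached from `S` are productive, and `T ⊆ P`. -/
def IsTLR (eof : T) (G : Grammar E) : Prop :=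
  G.cfg.WellFormed eof ∧ G.cfg.Productive ∧ G.cfg.IsLR1 ∧ G.trans ⊆ G.cfg.rules

/-- Rightmost derivations that use no transformative production. -/
def NontransDerives (G : Grammar E) : List (Symbol T ν) → List (Symbol T ν) → Prop :=
  RightDerives {r | r ∈ G.cfg.rules ∧ r ∉ G.trans}

/-- The configurations `(α x, u, G)` that semiparses relate. The string `α x` comes with its division
into the part `α` that is already processed and the unread input `x`. Only the context-free part
of the grammar is recorded, as `T` and `M` never change. -/
structure Form (Γ T ν : Type*) where
  processed : List (Symbol T ν)
  unread : List T
  memory : List Γ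
  cfg : CFG T ν

/-- `G.ValidSemiparse eof (α x, u, H) (β z, w, H')`: the form `(β z, w, H')` is a valid semiparse for
`(α x, u, H)`, where `H`, `H'` stand for the grammars `G.withCFG H`, `G.withCFG H'`. The end marker
is not written in `x` and `z`, so the terminal after `β` is the first symbol of `z ⊣`. -/
inductive ValidSemiparse (eof : T) (G : Grammar E) : Form G.M.Γ₂ T ν → Form G.M.Γ₂ T ν → Prop
  | final (α : List (Symbol T ν)) (x : List T) (u w : List G.M.Γ₂) (H : CFG T ν) :
      (G.withCFG H).IsTLR eof →
      (G.withCFG H).NontransDerives [Symbol.nonterminal H.start]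
        (α ++ x.map Symbol.terminal) →
      ValidSemiparse eof G ⟨α, x, u, H⟩ ⟨[Symbol.nonterminal H.start], [], w, H⟩
  | transform (α β' : List (Symbol T ν)) (r : ContextFreeRule T ν) (y z : List T)
      (u w : List G.M.Γ₂) (H : CFG T ν) (Δ : Transformation T ν) :
      (G.withCFG H).IsTLR eof →
      (G.withCFG (Δ.apply H)).IsTLR eof →
      r ∈ H.rules → r ∈ G.trans →
      (G.withCFG H).NontransDerives (β' ++ r.output ++ z.map Symbol.terminal)
        (α ++ (y ++ z).map Symbol.terminal) →
      (Δ.apply H).ViableFollowedBy eof (β' ++ [Symbol.nonterminal r.input]) (z.headD eof) →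
      G.M.Outputs y u H w Δ →
      Δ.ValidFor eof H β' r.input (z.headD eof) →
      ValidSemiparse eof G ⟨α, y ++ z, u, H⟩
        ⟨β' ++ [Symbol.nonterminal r.input], z, w, Δ.apply H⟩

/-- The language generated by `G`: the strings `x` for which there is a chain of at least one valid
semiparse from `(x, ε, G)` to some `(S, w, G')`. -/
def language (eof : T) (G : Grammar E) : Language T :=
  {x | ∃ w H, Relation.TransGen (G.ValidSemiparse eof) ⟨[], x, [], G.cfg⟩
    ⟨[Symbol.nonterminal G.cfg.start], [], w, H⟩}

end Grammar

/-! ### The canonical LR(1) parsing tables -/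

/-- An LR(1) item `[A → α · β, a]` of the augmented grammar, where `S'` is `none`. -/
structure Item (T ν : Type*) where
  lhs : Option ν
  before : List (Symbol T ν)
  after : List (Symbol T ν)
  look : T

namespace CFG

/-- The closure of an item set: if it contains `[A → α · B β, a]`, then it contains `[B → · γ, b]`
for every production `B → γ` and every `b ∈ FIRST(β a)`. -/
inductive Closure (G : CFG T ν) (K : Set (Item T ν)) : Item T ν → Prop
  | base (i : Item T ν) : i ∈ K → Closure G K i
  | step (i : Item T ν) (r : ContextFreeRule T ν) (β : List (Symbol T ν)) (b : T) :
      Closure G K i → i.after = Symbol.nonterminal r.input :: β → r ∈ G.rules →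
      b ∈ G.first (β ++ [Symbol.terminal i.look]) →
      Closure G K ⟨some r.input, [], r.output, b⟩

/-- The states of the parser are the closed item sets. State `0` is the closure of `[S' → · S, ⊣]`. -/
def initialState (eof : T) (G : CFG T ν) : Set (Item T ν) :=
  {i | G.Closure {⟨none, [], [Symbol.nonterminal G.start], eof⟩} i}

open Classical in
/-- The goto function: the closure of the items that arise by moving the dot over `X`; it is
undefined if there are none. -/
noncomputable def goto (G : CFG T ν) (s : Set (Item T ν)) (X : Symbol T ν) :
    Option (Set (Item T ν)) :=
  if ∃ i ∈ s, ∃ β, i.after = X :: β then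
    some {j | G.Closure {k | ∃ i ∈ s, ∃ β, i.after = X :: β ∧
      k = ⟨i.lhs, i.before ++ [X], β, i.look⟩} j}
  else none

end CFG

/-- The entries of the action table. -/
inductive Action (T ν : Type*)
  | shift : Action T ν
  | reduce (r : ContextFreeRule T ν) : Action T ν
  | accept : Action T ν
  | error : Action T ν

open Classical in
/-- The action function: shift `a` if there is an item `[A → α · a β, b]`; otherwise reduce by
`A → α` if there is an item `[A → α ·, a]`, where reducing by `S' → S` means accepting. -/
noncomputable def CFG.action (G : CFG T ν) (s : Set (Item T ν)) (a : T) : Action T ν :=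
  if ∃ i ∈ s, ∃ β, i.after = Symbol.terminal a :: β then .shift
  else if ⟨none, [Symbol.nonterminal G.start], [], a⟩ ∈ s then .accept
  else if h : ∃ r : ContextFreeRule T ν, ⟨some r.input, r.output, [], a⟩ ∈ s then
    .reduce h.choose
  else .error

/-! ### The parsing algorithm -/

/-- A parsing stack, with its top first: pairs of a state and a grammar symbol (`none` stands for `ε`
at the bottom of the stack). -/
abbrev Stack (T ν : Type*) := List (Set (Item T ν) × Option (Symbol T ν))

namespace Stack

/-- The symbols on the stack, from bottom to top. -/
def symbols (σ : Stack T ν) : List (Symbol T ν) := (σ.filterMap Prod.snd).reverse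

/-- Push `(goto[s, X], X)`, where `s` is the state on top of the stack; this fails if
`goto[s, X]` is undefined. -/
noncomputable def pushSymbol (G : CFG T ν) (X : Symbol T ν) : Stack T ν → Option (Stack T ν)
  | [] => none
  | (s, Y) :: σ => (G.goto s X).map fun s' => (s', some X) :: (s, Y) :: σ

/-- Push the symbols of a string one after another. -/
noncomputable def pushAll (G : CFG T ν) : List (Symbol T ν) → Stack T ν → Option (Stack T ν)
  | [], σ => some σ
  | X :: α, σ => (pushSymbol G X σ).bind (pushAll G α)

/-- The stack `(0, ε)`. -/
def initial (eof : T) (G : CFG T ν) : Stack T ν := [(G.initialState eof, none)]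

end Stack

/-- A state of the parsing algorithm: the current grammar, the stack, the remaining input (whose first
symbol is the lookahead), the string `w_Δ` of terminals shifted since the last transformation, and
the contents `z_Δ` of the second tape of the machine. -/
structure ParserState (Γ T ν : Type*) where
  cfg : CFG T ν
  stack : Stack T ν
  input : List T
  shifted : List T
  memory : List Γ

namespace Grammar

open Classical in
/-- The grammar transformation algorithm, called with the popped stack `σ` when a production with
head `A` is reduced and `a` is the lookahead: run the machine, assert that its output `Δ` is valid,
that is for the symbols on the stack followed by `A` and `a`, and that the new grammar is TLR, and
rebuild the stack with the tables of the new grammar. `none` means failure. -/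
noncomputable def transformStack (eof : T) (G : Grammar E) (H : CFG T ν) (σ : Stack T ν) (A : ν)
    (a : T) (y : List T) (u : List G.M.Γ₂) :
    Option (CFG T ν × Stack T ν × List G.M.Γ₂) :=
  if h : ∃ o : List G.M.Γ₂ × Transformation T ν, G.M.Outputs y u H o.1 o.2 then
    if h.choose.2.ValidFor eof H σ.symbols A a ∧
        (G.withCFG (h.choose.2.apply H)).IsTLR eof then
      (Stack.pushAll (h.choose.2.apply H) σ.symbols
        (Stack.initial eof (h.choose.2.apply H))).map
          fun σ' => (h.choose.2.apply H, σ', h.choose.1)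
    else none
  else none

open Classical in
/-- Reduce by the production `r` with lookahead `a`; `none` means failure. -/
noncomputable def reduceStep (eof : T) (G : Grammar E) (c : ParserState G.M.Γ₂ T ν)
    (r : ContextFreeRule T ν) (a : T) : Option (ParserState G.M.Γ₂ T ν) :=
  if r ∈ G.trans then
    (G.transformStack eof c.cfg (c.stack.drop r.output.length) r.input a c.shifted c.memory).bind
      fun o => (Stack.pushSymbol o.1 (Symbol.nonterminal r.input) o.2.1).map
        fun σ => ⟨o.1, σ, c.input, [], o.2.2⟩
  else
    (Stack.pushSymbol c.cfg (Symbol.nonterminal r.input) (c.stack.drop r.output.length)).map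
      fun σ => ⟨c.cfg, σ, c.input, c.shifted, c.memory⟩

/-- One step of the parsing algorithm: either it goes on with a new state, or it returns `true`
(accept) or `false` (reject). -/
noncomputable def parserStep (eof : T) (G : Grammar E) (c : ParserState G.M.Γ₂ T ν) :
    ParserState G.M.Γ₂ T ν ⊕ Bool :=
  match c.stack, c.input with
  | (s, _) :: _, a :: rest =>
    match c.cfg.action s a with
    | .shift =>
      match Stack.pushSymbol c.cfg (Symbol.terminal a) c.stack with
      | some σ => .inl ⟨c.cfg, σ, rest, c.shifted ++ [a], c.memory⟩
      | none => .inr false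
    | .reduce r =>
      match G.reduceStep eof c r a with
      | some c' => .inl c'
      | none => .inr false
    | .accept => .inr true
    | .error => .inr false
  | _, _ => .inr false

/-- Started with `G` and the input `x ⊣`, the parsing algorithm halts after finitely many steps and
returns `e`. -/
def ParserReturns (eof : T) (G : Grammar E) (x : List T) (e : Bool) : Prop :=
  ∃ c, Relation.ReflTransGen (fun c₁ c₂ => G.parserStep eof c₁ = .inl c₂)
    ⟨G.cfg, Stack.initial eof G.cfg, x ++ [eof], [], []⟩ c ∧ G.parserStep eof c = .inr e

end Grammar

end Languages

end TLR

/-!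
The proof compares the parser with the grammar that is current between two transformations, where
the classical theory of LR(1) parsing applies.

*The automaton.* `ItemReach` describes the parser state reached by reading `γ`. By
`ItemReach.lastStep` and `LastStep.itemReach` it consists of the items that are valid for `γ`.
Hence the LR(1) property makes the action table deterministic: `action_eq_reduce` says that at the
end of a handle the parser reduces by the right production, and
`viableFollowedBy_of_action_ne_error` says that it reports an error unless the stack is a viable
prefix followed by the lookahead.

*The language is accepted.* A valid semiparse is a nontransformative derivation, read backwards,
followed by one transformative reduction; the parser performs exactly these steps (`Grammar.run`,
`Grammar.returnsFrom_of_transGen`). The unread input need not complete the stack to a sentential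
form, but viability provides a continuation with the same lookahead, which is all that the parser
sees.

*Accepted strings are in the language.* Along an accepting run, the stack nontransformatively
derives the stack after the last transformation followed by the terminals shifted since then. A
semiparse requires moreover that the new stack is a viable prefix followed by the lookahead in the
transformed grammar. This holds because the parser of the transformed grammar does not report an
error in its next step (`Grammar.transGen_of_returnsFrom`).

*The parser halts.* This is where validity enters. The number of reductions that the parser is to
make before the next shift (`Pending`) is determined by the grammar, the stack and the lookahead.
In the derivation tree of a sentential form `α B a x` these reductions correspond to the interior
nodes that precede the leaf `a` without being its ancestors, that is, to those with the number
`n + 1`: their productions are conserved as a whole. The ancestors of `a` lead the parser to an item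
with the dot before `a`, and only the right sides up to the path to `a` matter for that, which is
the portion that is conserved. So a valid transformation leaves the number of pending reductions
unchanged (`exists_pending`), and every reduction lowers it by one (`Grammar.exists_returnsFrom`).
-/

namespace TLR

variable {T ν : Type*}

/-! ### Rightmost derivations -/

section Derivations

variable {R : Set (ContextFreeRule T ν)}

/-- The position of a symbol in a concatenation of two strings. -/
theorem append_cons_eq_append {β : Type*} {γ κ α δ : List β} {X : β}
    (h : γ ++ X :: κ = α ++ δ) :
    (∃ κ', α = γ ++ X :: κ' ∧ κ = κ' ++ δ) ∨ (∃ β', γ = α ++ β' ∧ δ = β' ++ X :: κ) := by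
  rcases List.append_eq_append_iff.1 h with ⟨c, h1, h2⟩ | ⟨c, h1, h2⟩
  · cases c with
    | nil => exact Or.inr ⟨[], by simpa using h1.symm, by simpa using h2.symm⟩
    | cons Y c =>
      simp only [List.cons_append, List.cons.injEq] at h2
      exact Or.inl ⟨c, by rw [h1, h2.1], h2.2⟩
  · exact Or.inr ⟨c, h1, h2⟩

theorem map_terminal_inj {v w : List T}
    (h : v.map (Symbol.terminal : T → Symbol T ν) = w.map Symbol.terminal) : v = w :=
  List.map_injective_iff.2 (fun _ _ h => Symbol.terminal.inj h) h

theorem not_nonterminal_mem_map {A : ν} {w : List T} :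
    (Symbol.nonterminal A : Symbol T ν) ∉ w.map Symbol.terminal := by simp

theorem RightStep.append_left {u v : List (Symbol T ν)} (h : RightStep R u v)
    (γ : List (Symbol T ν)) : RightStep R (γ ++ u) (γ ++ v) := by
  obtain ⟨r, hr, α, w, rfl, rfl⟩ := h
  exact ⟨r, hr, γ ++ α, w, by simp, by simp⟩

theorem RightStep.append_right {u v : List (Symbol T ν)} (h : RightStep R u v) (x : List T) :
    RightStep R (u ++ x.map Symbol.terminal) (v ++ x.map Symbol.terminal) := by
  obtain ⟨r, hr, α, w, rfl, rfl⟩ := h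
  exact ⟨r, hr, α, w ++ x, by simp, by simp⟩

theorem RightDerives.append_left {u v : List (Symbol T ν)} (h : RightDerives R u v)
    (γ : List (Symbol T ν)) : RightDerives R (γ ++ u) (γ ++ v) :=
  Relation.ReflTransGen.lift (γ ++ ·) (fun _ _ h => RightStep.append_left h γ) _ _ h

theorem RightDerives.append_right {u v : List (Symbol T ν)} (h : RightDerives R u v)
    (x : List T) : RightDerives R (u ++ x.map Symbol.terminal) (v ++ x.map Symbol.terminal) :=
  Relation.ReflTransGen.lift (· ++ x.map Symbol.terminal)
    (fun _ _ h => RightStep.append_right h x) _ _ h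

theorem RightDerives.mono {R' : Set (ContextFreeRule T ν)} (hR : R ⊆ R')
    {u v : List (Symbol T ν)} (h : RightDerives R u v) : RightDerives R' u v :=
  Relation.ReflTransGen.mono (fun _ _ ⟨r, hr, h⟩ => ⟨r, hR hr, h⟩) _ _ h

theorem RightDerives.trans {u v w : List (Symbol T ν)} (h : RightDerives R u v)
    (h' : RightDerives R v w) : RightDerives R u w :=
  Relation.ReflTransGen.trans h h'

theorem RightDerives.rule {r : ContextFreeRule T ν} (hr : r ∈ R) (α : List (Symbol T ν))
    (w : List T) :
    RightDerives R (α ++ Symbol.nonterminal r.input :: w.map Symbol.terminal)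
      (α ++ r.output ++ w.map Symbol.terminal) :=
  Relation.ReflTransGen.single ⟨r, hr, α, w, rfl, rfl⟩

/-- A rightmost derivation never touches a terminal suffix. -/
theorem RightStep.of_append_right {u v : List (Symbol T ν)} {x : List T}
    (h : RightStep R (u ++ x.map Symbol.terminal) v) :
    ∃ u', v = u' ++ x.map Symbol.terminal ∧ RightStep R u u' := by
  obtain ⟨r, hr, α, w, h1, rfl⟩ := h
  rcases append_cons_eq_append h1.symm with ⟨κ, rfl, h3⟩ | ⟨β', _, h3⟩
  · obtain ⟨w₁, w₂, rfl, h4, h5⟩ := List.map_eq_append_iff.1 h3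
    obtain rfl := map_terminal_inj h5
    subst h4
    exact ⟨α ++ r.output ++ w₁.map Symbol.terminal, by simp, r, hr, α, w₁, rfl, rfl⟩
  · exact absurd (h3 ▸ by simp : Symbol.nonterminal r.input ∈ x.map Symbol.terminal)
      not_nonterminal_mem_map

theorem RightDerives.of_append_right {u v : List (Symbol T ν)} {x : List T}
    (h : RightDerives R (u ++ x.map Symbol.terminal) v) :
    ∃ u', v = u' ++ x.map Symbol.terminal ∧ RightDerives R u u' := by
  induction h with
  | refl => exact ⟨u, rfl, .refl⟩
  | tail _ hs ih =>
    obtain ⟨u', rfl, hu⟩ := ih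
    obtain ⟨u'', rfl, hs'⟩ := hs.of_append_right
    exact ⟨u'', rfl, hu.tail hs'⟩

theorem RightDerives.of_append_right' {u v : List (Symbol T ν)} {x : List T}
    (h : RightDerives R (u ++ x.map Symbol.terminal) (v ++ x.map Symbol.terminal)) :
    RightDerives R u v := by
  obtain ⟨u', hu, h⟩ := h.of_append_right
  exact List.append_cancel_right hu ▸ h

theorem RightDerives.eq_of_terminal {w : List T} {v : List (Symbol T ν)}
    (h : RightDerives R (w.map Symbol.terminal) v) : v = w.map Symbol.terminal := by
  obtain ⟨u', rfl, h'⟩ := RightDerives.of_append_right (u := []) (x := w) (by simpa using h)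
  rcases Relation.ReflTransGen.cases_head h' with h | ⟨_, ⟨_, _, _, _, h, _⟩, _⟩
  · simp [← h]
  · simp at h

/-- If every nonterminal of a string derives a terminal string, then so does the whole string. -/
theorem exists_rightDerives_terminal {β : List (Symbol T ν)}
    (h : ∀ A, Symbol.nonterminal A ∈ β →
      ∃ w : List T, RightDerives R [Symbol.nonterminal A] (w.map Symbol.terminal)) :
    ∃ w : List T, RightDerives R β (w.map Symbol.terminal) := by
  induction β with
  | nil => exact ⟨[], .refl⟩
  | cons X β ih =>
    obtain ⟨w, hw⟩ := ih fun A hA => h A (List.mem_cons_of_mem _ hA)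
    have h1 := hw.append_left [X]
    cases X with
    | terminal c => exact ⟨c :: w, h1⟩
    | nonterminal A =>
      obtain ⟨v, hv⟩ := h A (by simp)
      have h2 := hv.append_right w
      refine ⟨v ++ w, ?_⟩
      rw [List.map_append]
      exact h1.trans h2

end Derivations

/-! ### Sentential forms and `FIRST` -/

namespace CFG

variable {eof : T} {G : CFG T ν}

theorem first_terminal (w : List T) :
    G.first (w.map Symbol.terminal) = {b | w.head? = some b} := by
  ext b
  constructor
  · rintro ⟨x, hx⟩
    obtain rfl := map_terminal_inj hx.eq_of_terminal
    rfl
  · intro h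
    obtain ⟨x, rfl⟩ := List.head?_eq_some_iff.1 h
    exact ⟨x, .refl⟩

theorem mem_first_append_terminal {κ : List (Symbol T ν)} {c b : T} :
    b ∈ G.first (κ ++ [Symbol.terminal c]) ↔
      ∃ x : List T, RightDerives ↑G.rules κ (x.map Symbol.terminal) ∧ x.headD c = b := by
  constructor
  · rintro ⟨x, hx⟩
    obtain ⟨u, hu, h⟩ := RightDerives.of_append_right (x := [c]) (by simpa using hx)
    obtain ⟨y, z, h1, rfl, h3⟩ := (List.map_eq_append_iff (l := b :: x)).1 hu
    obtain rfl := map_terminal_inj h3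
    refine ⟨y, h, ?_⟩
    cases y <;> simp_all
  · rintro ⟨x, hx, rfl⟩
    have := hx.append_right [c]
    cases x with
    | nil => exact ⟨[], by simpa using this⟩
    | cons b x => exact ⟨x ++ [c], by simpa using this⟩

theorem WellFormed.eof_notMem (hG : G.WellFormed eof) {ζ : List (Symbol T ν)}
    (h : RightDerives ↑G.rules [Symbol.nonterminal G.start] ζ) : Symbol.terminal eof ∉ ζ := by
  induction h with
  | refl => simp
  | tail _ hs ih =>
    obtain ⟨r, hr, α, w, rfl, rfl⟩ := hs
    have := (hG.2 r hr).2.2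
    simp_all

theorem headD_eq_iff {w y : List T} (hw : eof ∉ w) (hy : eof ∉ y) :
    w.headD eof = y.headD eof ↔ w.head? = y.head? := by
  cases w <;> cases y <;> simp_all [eq_comm]

/-- The sentential forms with end marker, in terms of the derivations from the start symbol. -/
theorem sentential_cons_iff (γ : List (Symbol T ν)) (a : T) :
    (∃ x : List T, G.Sentential eof (γ ++ Symbol.terminal a :: x.map Symbol.terminal)) ↔
      ∃ w : List T, RightDerives ↑G.rules [Symbol.nonterminal G.start]
        (γ ++ w.map Symbol.terminal) ∧ w.headD eof = a := by
  constructor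
  · rintro ⟨x, hx⟩
    obtain ⟨u, hu, h⟩ := RightDerives.of_append_right (u := [Symbol.nonterminal G.start])
      (x := [eof]) (by simpa [Sentential] using hx)
    rcases List.eq_nil_or_concat x with rfl | ⟨y, c, rfl⟩
    · have := List.append_inj' hu (by simp)
      refine ⟨[], by simpa [this.1] using h, by simpa [eq_comm] using this.2⟩
    · have : u = γ ++ Symbol.terminal a :: y.map Symbol.terminal := by
        refine (List.append_inj' (t₁ := [Symbol.terminal c]) (t₂ := [Symbol.terminal eof])
          ?_ rfl).1.symm
        simpa using hu
      exact ⟨a :: y, by simpa [this] using h, rfl⟩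
  · rintro ⟨w, hw, rfl⟩
    have := hw.append_right [eof]
    cases w with
    | nil => exact ⟨[], by simpa [Sentential] using this⟩
    | cons a w => exact ⟨w ++ [eof], by simpa [Sentential] using this⟩

theorem LastStep.rightDerives {α β : List (Symbol T ν)} {A : Option ν} {w : List T}
    (h : G.LastStep α A β w) :
    RightDerives ↑G.rules [Symbol.nonterminal G.start] (α ++ β ++ w.map Symbol.terminal) := by
  cases h with
  | augmented => exact .refl
  | production _ _ _ hr => exact RightDerives.trans ‹_› (.rule hr _ _)

theorem lastStep_some {α β : List (Symbol T ν)} {A : ν} {w : List T}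
    (h : G.LastStep α (some A) β w) : ∃ r ∈ G.rules, r.input = A ∧ r.output = β ∧
      RightDerives ↑G.rules [Symbol.nonterminal G.start]
        (α ++ Symbol.nonterminal A :: w.map Symbol.terminal) := by
  cases h with
  | production _ r _ hr h => exact ⟨r, hr, rfl, rfl, h⟩

end CFG

end TLR

namespace TLR

variable {T ν : Type*}

namespace CFG

variable {eof : T} {G : CFG T ν}

/-! ### The LR(1) automaton: items reached along a string -/

/-- `G.ItemReach eof γ i`: the item `i` belongs to the parser state that is reached from state `0`
by reading `γ` (the state is undefined if there is no such `i`). -/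
inductive ItemReach (eof : T) (G : CFG T ν) : List (Symbol T ν) → Item T ν → Prop
  | init : ItemReach eof G [] ⟨none, [], [Symbol.nonterminal G.start], eof⟩
  | closure (γ : List (Symbol T ν)) (i : Item T ν) (r : ContextFreeRule T ν)
      (β : List (Symbol T ν)) (b : T) :
      ItemReach eof G γ i → i.after = Symbol.nonterminal r.input :: β → r ∈ G.rules →
      b ∈ G.first (β ++ [Symbol.terminal i.look]) →
      ItemReach eof G γ ⟨some r.input, [], r.output, b⟩
  | shift (γ : List (Symbol T ν)) (i : Item T ν) (X : Symbol T ν) (β : List (Symbol T ν)) :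
      ItemReach eof G γ i → i.after = X :: β →
      ItemReach eof G (γ ++ [X]) ⟨i.lhs, i.before ++ [X], β, i.look⟩

/-- The parser has an item with the dot before `X` after reading `γ`. -/
def CanRead (eof : T) (G : CFG T ν) (γ : List (Symbol T ν)) (X : Symbol T ν) : Prop :=
  ∃ i, G.ItemReach eof γ i ∧ ∃ β, i.after = X :: β

theorem ItemReach.shiftAll {γ β₁ β₂ δ : List (Symbol T ν)} {A : Option ν} {b : T}
    (h : G.ItemReach eof γ ⟨A, δ, β₁ ++ β₂, b⟩) :
    G.ItemReach eof (γ ++ β₁) ⟨A, δ ++ β₁, β₂, b⟩ := by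
  induction β₁ generalizing γ δ with
  | nil => simpa using h
  | cons X β₁ ih => simpa using ih (.shift _ _ X (β₁ ++ β₂) h rfl)

/-- Every item in the state reached by `γ` is valid for `γ`. -/
theorem ItemReach.lastStep {γ : List (Symbol T ν)} {i : Item T ν} (h : G.ItemReach eof γ i) :
    ∃ α w, γ = α ++ i.before ∧ i.look = w.headD eof ∧
      G.LastStep α i.lhs (i.before ++ i.after) w := by
  induction h with
  | init => exact ⟨[], [], rfl, rfl, .augmented⟩
  | closure γ i r β b _ hi hr hb ih =>
    obtain ⟨α, w, rfl, hl, hs⟩ := ih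
    obtain ⟨x, hx, rfl⟩ := mem_first_append_terminal.1 hb
    refine ⟨α ++ i.before, x ++ w, by simp, by cases x <;> simp [hl], .production _ r _ hr ?_⟩
    have h1 := hs.rightDerives
    have h2 := (hx.append_right w).append_left (α ++ i.before ++ [Symbol.nonterminal r.input])
    rw [hi] at h1
    simp only [List.append_assoc, List.map_append, List.cons_append, List.nil_append] at h1 h2 ⊢
    exact h1.trans h2
  | shift γ i X β _ hi ih =>
    obtain ⟨α, w, rfl, hl, hs⟩ := ih
    exact ⟨α, w, by simp, hl, by simpa [hi] using hs⟩

/-- If `α A κ` is a sentential form and `κ` derives `x`, then all items `[A → · β, b]` with `b` the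
first symbol of `x ⊣` are in the state reached by `α`. -/
theorem ItemReach.of_rightDerives {ζ : List (Symbol T ν)}
    (h : RightDerives ↑G.rules [Symbol.nonterminal G.start] ζ) :
    ∀ (α κ : List (Symbol T ν)) (x : List T) (r : ContextFreeRule T ν),
      ζ = α ++ Symbol.nonterminal r.input :: κ → r ∈ G.rules →
      RightDerives ↑G.rules κ (x.map Symbol.terminal) →
      G.ItemReach eof α ⟨some r.input, [], r.output, x.headD eof⟩ := by
  induction h with
  | refl =>
    intro α κ x r h hr hx
    rcases α with _ | ⟨_, _ | _⟩ <;> simp at h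
    obtain ⟨h, rfl⟩ := h
    obtain rfl : x = [] := by
      have := RightDerives.eq_of_terminal (w := []) (by simpa using hx)
      simpa using this
    exact .closure _ _ r [] _ .init (by rw [h]) hr
      (mem_first_append_terminal.2 ⟨[], .refl, rfl⟩)
  | tail _ hs ih =>
    obtain ⟨r₁, hr₁, α₁, w₁, rfl, rfl⟩ := hs
    intro α κ x r h hr hx
    rw [List.append_assoc] at h
    rcases append_cons_eq_append h.symm with ⟨κ', rfl, rfl⟩ | ⟨β', rfl, h2⟩
    · refine ih α (κ' ++ Symbol.nonterminal r₁.input :: w₁.map Symbol.terminal) x r (by simp) hr ?_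
      refine RightDerives.trans ?_ hx
      simpa using RightDerives.rule (R := (G.rules : Set _)) hr₁ κ' w₁
    · rcases append_cons_eq_append h2.symm with ⟨κ', h3, rfl⟩ | ⟨_, _, h3⟩
      · have h4 := ih α₁ _ w₁ r₁ rfl hr₁ .refl
        rw [h3] at h4
        have h5 := h4.shiftAll
        obtain ⟨u, hu, hκ⟩ := hx.of_append_right
        obtain ⟨y, z, rfl, rfl, h6⟩ := List.map_eq_append_iff.1 hu
        obtain rfl := map_terminal_inj h6
        refine .closure _ _ r _ _ h5 rfl hr (mem_first_append_terminal.2 ⟨y, hκ, ?_⟩)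
        cases y <;> simp
      · exact absurd (h3 ▸ by simp : Symbol.nonterminal r.input ∈ w₁.map Symbol.terminal)
          not_nonterminal_mem_map

/-- Every item valid for `γ` is in the state reached by `γ`. -/
theorem LastStep.itemReach {α β₁ β₂ : List (Symbol T ν)} {A : Option ν} {w : List T}
    (h : G.LastStep α A (β₁ ++ β₂) w) :
    G.ItemReach eof (α ++ β₁) ⟨A, β₁, β₂, w.headD eof⟩ := by
  have : G.ItemReach eof α ⟨A, [], β₁ ++ β₂, w.headD eof⟩ := by
    generalize β₁ ++ β₂ = β at h
    cases h with
    | augmented => exact .init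
    | production _ r _ hr h => exact .of_rightDerives h α _ w r rfl hr .refl
  simpa using this.shiftAll

/-- The part of a sentential form up to its rightmost nonterminal can be read by the parser. -/
theorem canRead_of_rightDerives {ζ : List (Symbol T ν)}
    (h : RightDerives ↑G.rules [Symbol.nonterminal G.start] ζ) :
    ∀ (γ κ : List (Symbol T ν)) (X : Symbol T ν), ζ = γ ++ X :: κ →
      (∃ A, Symbol.nonterminal A ∈ X :: κ) → G.CanRead eof γ X := by
  induction h with
  | refl =>
    intro γ κ X h _
    rcases γ with _ | ⟨_, _ | _⟩ <;> simp at h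
    obtain ⟨rfl, rfl⟩ := h
    exact ⟨_, .init, [], rfl⟩
  | tail hd hs ih =>
    obtain ⟨r₁, hr₁, α₁, w₁, rfl, rfl⟩ := hs
    intro γ κ X h hX
    rw [List.append_assoc] at h
    rcases append_cons_eq_append h.symm with ⟨κ', rfl, rfl⟩ | ⟨β', rfl, h2⟩
    · exact ih γ (κ' ++ Symbol.nonterminal r₁.input :: w₁.map Symbol.terminal) X (by simp)
        ⟨r₁.input, by simp⟩
    · rcases append_cons_eq_append h2.symm with ⟨κ', h3, rfl⟩ | ⟨β'', rfl, h3⟩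
      · have h4 : G.LastStep α₁ (some r₁.input) (β' ++ X :: κ') w₁ := h3 ▸ .production _ _ _ hr₁ hd
        exact ⟨_, h4.itemReach, _, rfl⟩
      · obtain ⟨A, hA⟩ := hX
        exact absurd (h3 ▸ List.mem_append_right _ hA :
          Symbol.nonterminal A ∈ w₁.map Symbol.terminal) not_nonterminal_mem_map

/-- The parser can read `γ` symbol by symbol. -/
def Readable (eof : T) (G : CFG T ν) (γ : List (Symbol T ν)) : Prop :=
  ∀ γ₁ X γ₂, γ = γ₁ ++ X :: γ₂ → G.CanRead eof γ₁ X

theorem LastStep.readable {α β : List (Symbol T ν)} {A : Option ν} {w : List T}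
    (h : G.LastStep α A β w) : G.Readable eof (α ++ β) := by
  intro γ₁ X γ₂ hγ
  rcases append_cons_eq_append hγ.symm with ⟨κ, hκ, -⟩ | ⟨β', rfl, rfl⟩
  · cases h with
    | augmented => simp at hκ
    | production _ r _ hr h =>
      refine canRead_of_rightDerives h γ₁
        (κ ++ Symbol.nonterminal r.input :: w.map Symbol.terminal) X ?_ ⟨r.input, by simp⟩
      simp [hκ]
  · exact ⟨_, h.itemReach, _, rfl⟩

theorem ViablePrefix.readable {γ : List (Symbol T ν)} (h : G.ViablePrefix γ) :
    G.Readable eof γ := by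
  obtain ⟨α, A, β, w, h, δ, hδ⟩ := h
  intro γ₁ X γ₂ hγ
  exact h.readable γ₁ X (γ₂ ++ δ) (by rw [← hδ, hγ]; simp)

/-! ### Productive grammars -/

theorem ItemReach.reachable {γ : List (Symbol T ν)} {i : Item T ν} (h : G.ItemReach eof γ i) :
    ∀ A, Symbol.nonterminal A ∈ i.after → G.Reachable A := by
  induction h with
  | init =>
    intro A hA
    simp only [List.mem_singleton, Symbol.nonterminal.injEq] at hA
    exact hA ▸ .start
  | closure γ i r β b _ hi hr _ ih =>
    exact fun A hA => .step r A hr (ih _ (by simp [hi])) hA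
  | shift γ i X β _ hi ih => exact fun A hA => ih A (by rw [hi]; exact List.mem_cons_of_mem _ hA)

/-- What follows the dot in a reached item derives a terminal string. -/
theorem ItemReach.exists_terminal (hG : G.Productive) {γ : List (Symbol T ν)} {i : Item T ν}
    {X : Symbol T ν} {β : List (Symbol T ν)} (h : G.ItemReach eof γ i) (hi : i.after = X :: β) :
    ∃ x : List T, RightDerives ↑G.rules β (x.map Symbol.terminal) :=
  exists_rightDerives_terminal fun A hA =>
    hG A (h.reachable A (by rw [hi]; exact List.mem_cons_of_mem _ hA))

/-- If the parser can shift `a` after reading `γ`, then `γ` is a viable prefix followed by `a`. -/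
theorem CanRead.sentential (hG : G.Productive) {γ : List (Symbol T ν)} {a : T}
    (h : G.CanRead eof γ (Symbol.terminal a)) :
    G.ViablePrefix γ ∧ ∃ w : List T, RightDerives ↑G.rules [Symbol.nonterminal G.start]
      (γ ++ w.map Symbol.terminal) ∧ w.headD eof = a := by
  obtain ⟨i, hi, β, hβ⟩ := h
  obtain ⟨x, hx⟩ := hi.exists_terminal hG hβ
  obtain ⟨α, w, rfl, _, h⟩ := hi.lastStep
  refine ⟨⟨_, _, _, _, h, by simp⟩, a :: (x ++ w), ?_, rfl⟩
  have h1 := h.rightDerives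
  have h2 := (hx.append_right w).append_left (α ++ i.before ++ [Symbol.terminal a])
  rw [hβ] at h1
  simp only [List.append_assoc, List.map_append, List.cons_append, List.nil_append,
    List.map_cons] at h1 h2 ⊢
  exact h1.trans h2

/-! ### Determinism of the action table -/

/-- An LR(1) grammar has no shift-reduce conflict. -/
theorem IsLR1.not_canRead (hL : G.IsLR1) (hW : G.WellFormed eof) (hP : G.Productive)
    {α β : List (Symbol T ν)} {A : ν} {w : List T} (h : G.LastStep α (some A) β w) :
    ¬ G.CanRead eof (α ++ β) (Symbol.terminal (w.headD eof)) := by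
  rintro ⟨i, hi, β₂, hβ⟩
  obtain ⟨v, hv⟩ := hi.exists_terminal hP hβ
  obtain ⟨α', w', hα, -, h'⟩ := hi.lastStep
  have hd := h'.rightDerives
  have hw : eof ∉ w := fun hm => hW.eof_notMem h.rightDerives (by simp [hm])
  rw [hβ] at h' hd
  have hne : w.headD eof ≠ eof := fun he => hW.eof_notMem hd (by rw [he]; simp)
  -- the last step of a derivation of `α β a v w'`
  obtain ⟨γ, B, δ, x, hs, he, hx⟩ : ∃ γ B δ x, G.LastStep γ B δ x ∧
      γ ++ δ ++ x.map Symbol.terminal =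
        α ++ β ++ (w.headD eof :: (v ++ w')).map Symbol.terminal ∧
      x.length ≤ (v ++ w').length := by
    rcases Relation.ReflTransGen.cases_tail hv with hv | ⟨κ, hκ, r, hr, α₃, w₃, rfl, hv'⟩
    · exact ⟨_, _, _, _, h', by simp [hα, hv], by simp⟩
    · refine ⟨α ++ β ++ Symbol.terminal (w.headD eof) :: α₃, _, r.output, w₃ ++ w',
        .production _ r _ hr ?_, ?_, ?_⟩
      · have h2 := (RightDerives.append_right hκ w').append_left
          (α ++ β ++ [Symbol.terminal (w.headD eof)])
        rw [hα] at h2 ⊢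
        simp only [List.append_assoc, List.map_append, List.cons_append, List.nil_append] at hd h2 ⊢
        exact hd.trans h2
      · simp [hv']
      · have := congrArg List.length hv'
        simp at this ⊢
        omega
  have hf : G.first (w.map Symbol.terminal) =
      G.first ((w.headD eof :: (v ++ w')).map Symbol.terminal) := by
    rw [first_terminal, first_terminal]
    cases w <;> simp_all
  have := (hL _ _ _ _ _ _ _ _ _ h hs he hf).2.2
  simp [this] at hx

/-- An LR(1) grammar has no reduce-reduce conflict, where accepting counts as a reduction. -/
theorem IsLR1.lastStep_unique (hL : G.IsLR1) (hW : G.WellFormed eof)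
    {α β α' β' : List (Symbol T ν)} {A A' : Option ν} {w w' : List T} (h : G.LastStep α A β w)
    (h' : G.LastStep α' A' β' w') (hγ : α' ++ β' = α ++ β) (ha : w.headD eof = w'.headD eof) :
    α = α' ∧ A = A' ∧ β = β' := by
  have hw : eof ∉ w := fun hm => hW.eof_notMem h.rightDerives (by simp [hm])
  have hw' : eof ∉ w' := fun hm => hW.eof_notMem h'.rightDerives (by simp [hm])
  have hf : G.first (w.map Symbol.terminal) = G.first (w'.map Symbol.terminal) := by
    rw [first_terminal, first_terminal, (headD_eq_iff hw hw').1 ha]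
  obtain ⟨rfl, rfl, -⟩ := hL α β α' β' A A' w w' w' h h' (by rw [hγ]) hf
  exact ⟨rfl, rfl, (List.append_cancel_left hγ).symm⟩

end CFG

end TLR

namespace TLR

variable {T ν : Type*}

namespace CFG

variable {eof : T} {G : CFG T ν}

/-! ### The action table -/

/-- The parser state reached by reading `γ`. -/
def stateOf (eof : T) (G : CFG T ν) (γ : List (Symbol T ν)) : Set (Item T ν) :=
  {i | G.ItemReach eof γ i}

theorem action_eq_shift_iff {s : Set (Item T ν)} {a : T} :
    G.action s a = .shift ↔ ∃ i ∈ s, ∃ β, i.after = Symbol.terminal a :: β := by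
  unfold action
  split_ifs <;> simp_all

theorem action_eq_accept_iff (hW : G.WellFormed eof) {γ : List (Symbol T ν)} {a : T} :
    G.action (G.stateOf eof γ) a = .accept ↔ γ = [Symbol.nonterminal G.start] ∧ a = eof := by
  have hsh (h : G.CanRead eof γ (Symbol.terminal eof)) : False := by
    obtain ⟨i, hi, β, hβ⟩ := h
    obtain ⟨α, w, rfl, -, h⟩ := hi.lastStep
    exact hW.eof_notMem h.rightDerives (by simp [hβ])
  constructor
  · intro h
    unfold action at h
    split_ifs at h with h1 h2
    obtain ⟨α, w, h3, h4, h5⟩ := ItemReach.lastStep (show G.ItemReach eof γ _ from h2)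
    cases h5 with
    | augmented => exact ⟨h3, h4⟩
  · rintro ⟨rfl, rfl⟩
    have h : G.ItemReach a [Symbol.nonterminal G.start]
        ⟨none, [Symbol.nonterminal G.start], [], a⟩ :=
      .shift [] ⟨none, [], [Symbol.nonterminal G.start], a⟩ _ [] .init rfl
    unfold action
    exact (if_neg hsh).trans (if_pos h)

theorem lastStep_of_action_eq_reduce {γ : List (Symbol T ν)} {a : T} {r : ContextFreeRule T ν}
    (h : G.action (G.stateOf eof γ) a = .reduce r) :
    ∃ α w, γ = α ++ r.output ∧ a = w.headD eof ∧ G.LastStep α (some r.input) r.output w := by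
  unfold action at h
  split_ifs at h with h1 h2 h3
  have h4 := h3.choose_spec
  rw [Action.reduce.inj h] at h4
  obtain ⟨α, w, h5, h6, h7⟩ := ItemReach.lastStep (show G.ItemReach eof γ _ from h4)
  exact ⟨α, w, h5, h6, by simpa using h7⟩

theorem LastStep.mem_rules {α : List (Symbol T ν)} {r : ContextFreeRule T ν} {w : List T}
    (h : G.LastStep α (some r.input) r.output w) : r ∈ G.rules := by
  obtain ⟨r', hr, h1, h2, -⟩ := lastStep_some h
  rwa [show r = r' from ContextFreeRule.ext h1.symm h2.symm]

theorem action_eq_reduce (hL : G.IsLR1) (hW : G.WellFormed eof) (hP : G.Productive)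
    {α : List (Symbol T ν)} {r : ContextFreeRule T ν} {w : List T}
    (h : G.LastStep α (some r.input) r.output w) :
    G.action (G.stateOf eof (α ++ r.output)) (w.headD eof) = .reduce r := by
  have hi : G.ItemReach eof (α ++ r.output) ⟨some r.input, r.output, [], w.headD eof⟩ :=
    LastStep.itemReach (by simpa using h)
  have h3 : ∃ r' : ContextFreeRule T ν,
      (⟨some r'.input, r'.output, [], w.headD eof⟩ : Item T ν) ∈ G.stateOf eof (α ++ r.output) :=
    ⟨r, hi⟩
  unfold action
  refine (if_neg (hL.not_canRead hW hP h)).trans ?_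
  rw [if_neg, dif_pos h3]
  · obtain ⟨α', w', h4, h5, h6⟩ :=
      ItemReach.lastStep (show G.ItemReach eof (α ++ r.output) _ from h3.choose_spec)
    obtain ⟨-, h7, h8⟩ := hL.lastStep_unique hW h h6 (by simpa using h4.symm) h5
    exact congrArg _ (ContextFreeRule.ext (Option.some.inj h7).symm (by simpa using h8.symm))
  · intro h2
    obtain ⟨α', w', h4, h5, h6⟩ :=
      ItemReach.lastStep (show G.ItemReach eof (α ++ r.output) _ from h2)
    have := (hL.lastStep_unique hW h h6 (by simpa using h4.symm) h5).2.1
    simp at this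

/-- If the parser does not report an error, then the stack is a viable prefix followed by the
lookahead. -/
theorem viableFollowedBy_of_action_ne_error (hW : G.WellFormed eof) (hP : G.Productive)
    {γ : List (Symbol T ν)} {a : T} (h : G.action (G.stateOf eof γ) a ≠ .error) :
    G.ViableFollowedBy eof γ a := by
  rw [ViableFollowedBy, sentential_cons_iff]
  rcases h' : G.action (G.stateOf eof γ) a with _ | r | _ | _
  · exact CanRead.sentential hP (action_eq_shift_iff.1 h')
  · obtain ⟨α, w, rfl, rfl, hs⟩ := lastStep_of_action_eq_reduce h'
    exact ⟨⟨_, _, _, _, hs, List.prefix_rfl⟩, w, hs.rightDerives, rfl⟩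
  · obtain ⟨rfl, rfl⟩ := (action_eq_accept_iff hW).1 h'
    exact ⟨⟨_, _, _, _, .augmented, List.prefix_rfl⟩, [], .refl, rfl⟩
  · exact absurd h' h

end CFG

/-! ### Parsing stacks -/

open CFG

theorem CFG.initialState_eq (eof : T) (G : CFG T ν) : G.initialState eof = G.stateOf eof [] := by
  ext i
  constructor
  · intro h
    change G.Closure _ i at h
    induction h with
    | base i hi => exact (Set.mem_singleton_iff.1 hi) ▸ .init
    | step i r β b _ hi hr hb ih => exact .closure _ i r β b ih hi hr hb
  · intro h
    change G.ItemReach eof [] i at h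
    generalize hγ : ([] : List (Symbol T ν)) = γ at h
    induction h with
    | init => exact .base _ rfl
    | closure γ i r β b _ hi hr hb ih => exact Closure.step i r β b (ih hγ) hi hr hb
    | shift => simp at hγ

theorem CFG.goto_stateOf_eq_some_iff {eof : T} {G : CFG T ν} {γ : List (Symbol T ν)}
    {X : Symbol T ν} {s : Set (Item T ν)} :
    G.goto (G.stateOf eof γ) X = some s ↔
      G.CanRead eof γ X ∧ s = G.stateOf eof (γ ++ [X]) := by
  have key : {j | G.Closure {k | ∃ i ∈ G.stateOf eof γ, ∃ β, i.after = X :: β ∧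
      k = ⟨i.lhs, i.before ++ [X], β, i.look⟩} j} = G.stateOf eof (γ ++ [X]) := by
    ext j
    constructor
    · intro h
      change G.Closure _ j at h
      induction h with
      | base k hk =>
        obtain ⟨i, hi, β, hβ, rfl⟩ := hk
        exact .shift γ i X β hi hβ
      | step i r β b _ hi hr hb ih => exact .closure _ i r β b ih hi hr hb
    · intro h
      change G.ItemReach eof _ j at h
      generalize hγ : γ ++ [X] = δ at h
      induction h with
      | init => simp at hγ
      | closure δ i r β b _ hi hr hb ih => exact Closure.step i r β b (ih hγ) hi hr hb
      | shift δ i Y β h hi =>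
        obtain ⟨rfl, h2⟩ := List.append_inj' hγ rfl
        obtain rfl : X = Y := by simpa using h2
        exact .base _ ⟨i, h, β, hi, rfl⟩
  unfold goto
  rw [key]
  split_ifs with h
  · simp only [Option.some.injEq, eq_comm (a := s)]
    exact ⟨fun h' => ⟨h, h'⟩, fun h' => h'.2⟩
  · simp only [false_iff, not_and]
    exact fun h' => absurd h' h

/-- `IsStack eof G γ σ`: the stack `σ` holds the symbols `γ` and the states that the parser of `G`
reaches by reading them. -/
inductive IsStack (eof : T) (G : CFG T ν) : List (Symbol T ν) → Stack T ν → Prop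
  | initial : IsStack eof G [] (Stack.initial eof G)
  | push (γ : List (Symbol T ν)) (σ : Stack T ν) (X : Symbol T ν) : IsStack eof G γ σ →
      G.CanRead eof γ X → IsStack eof G (γ ++ [X]) ((G.stateOf eof (γ ++ [X]), some X) :: σ)

namespace IsStack

variable {eof : T} {G : CFG T ν} {γ : List (Symbol T ν)} {σ σ' : Stack T ν}

theorem eq_cons (h : IsStack eof G γ σ) : ∃ Y σ', σ = (G.stateOf eof γ, Y) :: σ' := by
  cases h with
  | initial => exact ⟨none, [], by rw [Stack.initial, initialState_eq]⟩
  | push γ σ X => exact ⟨_, _, rfl⟩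

theorem symbols_eq (h : IsStack eof G γ σ) : σ.symbols = γ := by
  induction h with
  | initial => rfl
  | push γ σ X _ _ ih => simp_all [Stack.symbols]

theorem drop {α β : List (Symbol T ν)} (h : IsStack eof G (α ++ β) σ) :
    IsStack eof G α (σ.drop β.length) := by
  induction β using List.reverseRecOn generalizing σ with
  | nil => simpa using h
  | append_singleton β Y ih =>
    generalize hγ : α ++ (β ++ [Y]) = γ at h
    cases h with
    | initial => simp at hγ
    | push γ σ X h _ =>
      rw [← List.append_assoc] at hγ
      obtain ⟨rfl, -⟩ := List.append_inj' hγ rfl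
      simpa using ih h

theorem pushSymbol_eq_some_iff (h : IsStack eof G γ σ) {X : Symbol T ν} :
    Stack.pushSymbol G X σ = some σ' ↔
      G.CanRead eof γ X ∧ σ' = (G.stateOf eof (γ ++ [X]), some X) :: σ := by
  obtain ⟨Y, τ, rfl⟩ := h.eq_cons
  simp only [Stack.pushSymbol, Option.map_eq_some_iff, goto_stateOf_eq_some_iff]
  constructor
  · rintro ⟨s, ⟨h1, rfl⟩, rfl⟩
    exact ⟨h1, rfl⟩
  · rintro ⟨h1, rfl⟩
    exact ⟨_, ⟨h1, rfl⟩, rfl⟩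

theorem of_pushSymbol (h : IsStack eof G γ σ) {X : Symbol T ν}
    (h' : Stack.pushSymbol G X σ = some σ') : IsStack eof G (γ ++ [X]) σ' := by
  obtain ⟨h1, rfl⟩ := h.pushSymbol_eq_some_iff.1 h'
  exact .push _ _ _ h h1

theorem exists_pushSymbol (h : IsStack eof G γ σ) {X : Symbol T ν} (hX : G.CanRead eof γ X) :
    ∃ σ', Stack.pushSymbol G X σ = some σ' ∧ IsStack eof G (γ ++ [X]) σ' :=
  ⟨_, h.pushSymbol_eq_some_iff.2 ⟨hX, rfl⟩, .push _ _ _ h hX⟩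

theorem of_pushAll {α : List (Symbol T ν)} (h : IsStack eof G γ σ)
    (h' : Stack.pushAll G α σ = some σ') : IsStack eof G (γ ++ α) σ' := by
  induction α generalizing γ σ with
  | nil =>
    obtain rfl : σ = σ' := by simpa [Stack.pushAll] using h'
    simpa using h
  | cons X α ih =>
    obtain ⟨τ, h1, h2⟩ := Option.bind_eq_some_iff.1 h'
    simpa using ih (h.of_pushSymbol h1) h2

theorem exists_pushAll {α : List (Symbol T ν)} (h : IsStack eof G γ σ)
    (hα : ∀ α₁ X α₂, α = α₁ ++ X :: α₂ → G.CanRead eof (γ ++ α₁) X) :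
    ∃ σ', Stack.pushAll G α σ = some σ' ∧ IsStack eof G (γ ++ α) σ' := by
  induction α generalizing γ σ with
  | nil => exact ⟨σ, rfl, by simpa using h⟩
  | cons X α ih =>
    obtain ⟨τ, h1, h2⟩ := h.exists_pushSymbol (X := X) (by simpa using hα [] X α rfl)
    obtain ⟨σ', h3, h4⟩ := ih h2 fun α₁ Y α₂ he => by
      simpa using hα (X :: α₁) Y α₂ (by simp [he])
    exact ⟨σ', by simp [Stack.pushAll, h1, h3], by simpa using h4⟩

end IsStack

/-! ### Uniqueness of the output of a machine -/

theorem Tape.Holds.unique {Γ : Type*} {t : Tape Γ} {l l' : List Γ} (h : t.Holds l)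
    (h' : t.Holds l') : l = l' := by
  have hlen : ∀ {l l' : List Γ}, t.Holds l → t.Holds l' → l.length ≤ l'.length := by
    intro l l' h h'
    by_contra! hlt
    have h1 := h _ hlt.le
    rw [h' _ le_rfl] at h1
    simp [hlt] at h1
  have hl := le_antisymm (hlen h h') (hlen h' h)
  refine List.ext_getElem? fun i => ?_
  rcases le_or_gt i l.length with hi | hi
  · rw [← h i hi, h' i (hl ▸ hi)]
  · rw [List.getElem?_eq_none hi.le, List.getElem?_eq_none (hl ▸ hi.le)]

/-- Deterministic computations with the same start end in the same place. -/
theorem eq_of_reflTransGen_of_terminal {β : Type*} {r : β → β → Prop} {a b c : β}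
    (hr : ∀ a b c, r a b → r a c → b = c) (hb : Relation.ReflTransGen r a b)
    (hc : Relation.ReflTransGen r a c) (hb' : ∀ d, ¬ r b d) (hc' : ∀ d, ¬ r c d) : b = c := by
  rcases Relation.ReflTransGen.total_of_right_unique hr hb hc with h | h
  · exact (Relation.ReflTransGen.cases_head h).resolve_right fun ⟨d, hd, _⟩ => hb' d hd
  · exact ((Relation.ReflTransGen.cases_head h).resolve_right fun ⟨d, hd, _⟩ => hc' d hd).symm

theorem TM3.HaltsAt.unique {Q Γ₁ Γ₂ Γ₃ : Type*} {M : TM3 Q Γ₁ Γ₂ Γ₃} {y : List Γ₁} {u : List Γ₂}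
    {g : List Γ₃} {c c' : TM3.Config Q Γ₁ Γ₂ Γ₃} (h : M.HaltsAt y u g c)
    (h' : M.HaltsAt y u g c') : c = c' := by
  refine eq_of_reflTransGen_of_terminal (fun a b c hb hc => Option.some.inj (hb.symm.trans hc))
    h.1 h'.1 (fun d hd => ?_) fun d hd => ?_
  · simp [h.2] at hd
  · simp [h'.2] at hd

theorem DeltaMachine.Outputs.unique {C : Type*} {E : Coding T ν C} {M : DeltaMachine E}
    {y : List T} {u w w' : List M.Γ₂} {G : CFG T ν} {Δ Δ' : Transformation T ν}
    (h : M.Outputs y u G w Δ) (h' : M.Outputs y u G w' Δ') : w = w' ∧ Δ = Δ' := by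
  obtain ⟨c, hc, h2, h3⟩ := h
  obtain ⟨c', hc', h2', h3'⟩ := h'
  obtain rfl := hc.unique hc'
  exact ⟨h2.unique h2', E.transformation_injective
    (List.map_injective_iff.2 M.ι₃.injective (h3.unique h3'))⟩

end TLR

namespace TLR

variable {T ν : Type*}

open CFG

/-! ### Derivation trees of rightmost derivations -/

namespace PTree

mutual
/-- The number of interior nodes of a tree. -/
def size : PTree T ν → ℕ
  | leaf _ => 0
  | node _ cs => forestSize cs + 1
/-- The number of interior nodes of a sequence of trees. -/
def forestSize : List (PTree T ν) → ℕ
  | [] => 0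
  | t :: ts => size t + forestSize ts
end

/-- A sequence of derivation trees over the productions `R` that comes from a rightmost derivation.
When a node was expanded, everything to its right was terminal, so all later siblings of an interior
node have terminal yields. -/
inductive RightForest (R : Set (ContextFreeRule T ν)) : List (PTree T ν) → Prop
  | nil : RightForest R []
  | leaf (X : Symbol T ν) (ts : List (PTree T ν)) : RightForest R ts →
      RightForest R (leaf X :: ts)
  | node (r : ContextFreeRule T ν) (cs ts : List (PTree T ν)) : r ∈ R → cs.map root = r.output →
      RightForest R cs → RightForest R ts → (∀ A, Symbol.nonterminal A ∉ frontierList ts) →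
      RightForest R (node r cs :: ts)

variable {R R' : Set (ContextFreeRule T ν)} {ts ts₁ ts₂ ts₃ cs : List (PTree T ν)}

@[simp] theorem frontierList_nil : frontierList ([] : List (PTree T ν)) = [] := by
  simp [frontierList]

@[simp] theorem frontierList_cons (t : PTree T ν) :
    frontierList (t :: ts) = frontier t ++ frontierList ts := by
  simp [frontierList]

@[simp] theorem frontier_leaf (X : Symbol T ν) : frontier (leaf X) = [X] := by
  simp [frontier]

@[simp] theorem frontier_node (r : ContextFreeRule T ν) :
    frontier (node r cs) = frontierList cs := by
  simp [frontier]

@[simp] theorem frontierList_append :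
    frontierList (ts₁ ++ ts₂) = frontierList ts₁ ++ frontierList ts₂ := by
  induction ts₁ with
  | nil => simp
  | cons t ts₁ ih => simp [ih]

/-! #### Nodes and their paths -/

@[simp] theorem nodeAt_path_nil : nodeAt ts [] = none := by simp [nodeAt]

theorem nodeAt_cons_iff {i : ℕ} {p : List ℕ} {t : PTree T ν} :
    nodeAt ts (i :: p) = some t ↔
      (p = [] ∧ ts[i]? = some t) ∨ ∃ r cs, ts[i]? = some (node r cs) ∧ nodeAt cs p = some t := by
  cases p with
  | nil => simp [nodeAt]
  | cons j p =>
    have hnil : nodeAt ([] : List (PTree T ν)) (j :: p) = none := by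
      cases p <;> simp [nodeAt]
    rcases h : ts[i]? with _ | _ | _ <;> simp [nodeAt, h, children, hnil]

theorem nodeAt_cons_succ {t : PTree T ν} {i : ℕ} {p : List ℕ} :
    nodeAt (t :: ts) ((i + 1) :: p) = nodeAt ts (i :: p) := by
  cases p <;> simp [nodeAt]

theorem nodeAt_node_zero {r : ContextFreeRule T ν} {p : List ℕ} {t : PTree T ν}
    (h : nodeAt cs p = some t) : nodeAt (node r cs :: ts) (0 :: p) = some t :=
  nodeAt_cons_iff.2 (.inr ⟨r, cs, rfl, h⟩)

theorem nodeAt_append_path {p q : List ℕ} {r : ContextFreeRule T ν}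
    (h : nodeAt ts p = some (node r cs)) {t : PTree T ν} (h' : nodeAt ts (p ++ q) = some t)
    (hq : q ≠ []) : nodeAt cs q = some t := by
  induction p generalizing ts with
  | nil => simp at h
  | cons i p ih =>
    rcases nodeAt_cons_iff.1 h with ⟨rfl, h1⟩ | ⟨r', cs', h1, h2⟩
    · rcases nodeAt_cons_iff.1 h' with ⟨h3, -⟩ | ⟨r'', cs'', h3, h4⟩
      · exact absurd h3 (by simpa using hq)
      · rw [h1] at h3
        cases h3
        exact h4
    · rcases nodeAt_cons_iff.1 h' with ⟨h3, -⟩ | ⟨r'', cs'', h3, h4⟩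
      · simp_all
      · rw [h1] at h3
        cases h3
        exact ih h2 h4

theorem nodeAt_append {p : List ℕ} {t : PTree T ν} (h : nodeAt (ts₁ ++ ts₂) p = some t) :
    (nodeAt ts₁ p = some t ∧ ∃ k p', p = k :: p' ∧ k < ts₁.length) ∨
      ∃ q, nodeAt ts₂ q = some t := by
  cases p with
  | nil => simp at h
  | cons i p =>
    rcases lt_or_ge i ts₁.length with hi | hi
    · rw [nodeAt_cons_iff, List.getElem?_append_left hi, ← nodeAt_cons_iff] at h
      exact .inl ⟨h, i, p, rfl, hi⟩
    · rw [nodeAt_cons_iff, List.getElem?_append_right hi, ← nodeAt_cons_iff] at h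
      exact .inr ⟨_, h⟩

theorem mem_frontierList_of_nodeAt {p : List ℕ} {X : Symbol T ν}
    (h : nodeAt ts p = some (leaf X)) : X ∈ frontierList ts := by
  induction p generalizing ts with
  | nil => simp at h
  | cons i p ih =>
    have key {t : PTree T ν} (ht : ts[i]? = some t) (hX : X ∈ frontier t) :
        X ∈ frontierList ts := by
      obtain ⟨u, v, rfl⟩ := List.append_of_mem (List.mem_of_getElem? ht)
      simp [hX]
    rcases nodeAt_cons_iff.1 h with ⟨rfl, h1⟩ | ⟨r, cs, h1, h2⟩
    · exact key h1 (by simp)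
    · exact key h1 (by simpa using ih h2)

/-! #### The forest to the left of a path -/

/-- The trees that hang to the left of a path: the left siblings of the nodes on the path, from
left to right. -/
def leftForest : List (PTree T ν) → List ℕ → List (PTree T ν)
  | _, [] => []
  | ts, i :: p =>
    ts.take i ++
      match ts[i]? with
      | none => []
      | some t => leftForest t.children p

theorem leftForest_cons (i : ℕ) (p : List ℕ) :
    leftForest ts (i :: p) = ts.take i ∨ ∃ r cs ts', ts = ts.take i ++ node r cs :: ts' ∧
      ts[i]? = some (node r cs) ∧ leftForest ts (i :: p) = ts.take i ++ leftForest cs p := by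
  rcases h : ts[i]? with _ | X | ⟨r, cs⟩
  · simp [leftForest, h]
  · have : leftForest ([] : List (PTree T ν)) p = [] := by
      cases p <;> simp [leftForest]
    simp [leftForest, h, children, this]
  · refine .inr ⟨r, cs, ts.drop (i + 1), ?_, rfl, by simp [leftForest, h, children]⟩
    obtain ⟨hi, h⟩ := List.getElem?_eq_some_iff.1 h
    rw [← h, List.cons_getElem_drop_succ, List.take_append_drop]

theorem frontierList_leftForest (p : List ℕ) :
    frontierList (leftForest ts p) = yieldBefore ts p := by
  induction p generalizing ts with
  | nil => simp [leftForest, yieldBefore]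
  | cons i p ih => rcases h : ts[i]? with _ | t <;> simp [leftForest, yieldBefore, h, ih]

theorem mem_frontierList_leftForest {p : List ℕ} {X : Symbol T ν}
    (h : X ∈ frontierList (leftForest ts p)) : X ∈ frontierList ts := by
  induction p generalizing ts with
  | nil => simp [leftForest] at h
  | cons i p ih =>
    rcases leftForest_cons (ts := ts) i p with h1 | ⟨r, cs, ts', h1, -, h2⟩
    · rw [← List.take_append_drop i ts, frontierList_append]
      exact List.mem_append_left _ (h1 ▸ h)
    · rw [h1]
      rw [h2] at h
      simp only [frontierList_append, List.mem_append, frontierList_cons, frontier_node] at h ⊢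
      exact h.imp_right fun h => .inl (ih h)

/-- The interior nodes to the left of a path, as nodes of the whole forest. -/
theorem exists_nodeAt_of_leftForest {a p : List ℕ} {r : ContextFreeRule T ν}
    (h : nodeAt (leftForest ts a) p = some (node r cs)) :
    ∃ q, nodeAt ts q = some (node r cs) ∧ q < a ∧ ¬ q <+: a := by
  induction a generalizing ts p with
  | nil => cases p with
    | nil => simp at h
    | cons i p => simp [leftForest, nodeAt_cons_iff] at h
  | cons i a ih =>
    have key {p} (h : nodeAt (ts.take i) p = some (node r cs)) :
        ∃ q, nodeAt ts q = some (node r cs) ∧ q < i :: a ∧ ¬ q <+: i :: a := by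
      rcases p with _ | ⟨k, p⟩
      · simp at h
      have hk : k < i := by
        by_contra hk
        rw [nodeAt_cons_iff] at h
        simp_all
      rw [nodeAt_cons_iff, List.getElem?_take_of_lt hk, ← nodeAt_cons_iff] at h
      refine ⟨_, h, List.cons_lt_cons_iff.2 (.inl hk), fun h => ?_⟩
      exact hk.ne (List.cons_prefix_cons.1 h).1
    rcases leftForest_cons (ts := ts) i a with h1 | ⟨r', cs', ts', -, h0, h1⟩
    · exact key (h1 ▸ h)
    · rw [h1] at h
      rcases nodeAt_append h with ⟨h, -⟩ | ⟨q, h⟩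
      · exact key h
      · obtain ⟨q, h2, h3, h4⟩ := ih h
        refine ⟨i :: q, nodeAt_cons_iff.2 (.inr ⟨_, _, h0, h2⟩),
          List.cons_lt_cons_iff.2 (.inr ⟨rfl, h3⟩), fun h => h4 (List.cons_prefix_cons.1 h).2⟩

namespace RightForest

theorem right_of_append (h : RightForest R (ts₁ ++ ts₂)) : RightForest R ts₂ := by
  induction ts₁ with
  | nil => exact h
  | cons t ts₁ ih => cases h <;> exact ih ‹_›

/-- The right part of a forest may be replaced if no nonterminal is introduced there. -/
theorem append_of_append (h : RightForest R (ts₁ ++ ts₂)) (h₃ : RightForest R ts₃)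
    (hf : ∀ A, Symbol.nonterminal A ∈ frontierList ts₃ →
      Symbol.nonterminal A ∈ frontierList ts₂) : RightForest R (ts₁ ++ ts₃) := by
  induction ts₁ with
  | nil => exact h₃
  | cons t ts₁ ih =>
    cases h with
    | leaf X _ h => exact .leaf _ _ (ih h)
    | node r cs _ hr hc hcs h hA =>
      refine .node r cs _ hr hc hcs (ih h) fun A h => hA A ?_
      change _ ∈ frontierList (ts₁ ++ ts₃) at h
      change _ ∈ frontierList (ts₁ ++ ts₂)
      simp only [frontierList_append, List.mem_append] at h ⊢
      exact h.imp_right (hf A)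

theorem left_of_append (h : RightForest R (ts₁ ++ ts₂)) : RightForest R ts₁ := by
  simpa using h.append_of_append .nil (by simp)

theorem isDerivation (h : RightForest R ts) : ∀ t ∈ ts, t.IsDerivation R := by
  induction h with
  | nil => simp
  | leaf X ts _ ih => simpa using ⟨.leaf X, ih⟩
  | node r cs ts hr hc _ _ _ ih₁ ih₂ => simpa using ⟨.node r cs hr hc ih₁, ih₂⟩

theorem frontierList_of_terminal (h : RightForest R ts) {w : List T}
    (hw : ts.map root = w.map Symbol.terminal) : frontierList ts = w.map Symbol.terminal := by
  induction h generalizing w with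
  | nil => simpa using hw
  | leaf X ts _ ih =>
    cases w with
    | nil => simp at hw
    | cons c w =>
      simp only [List.map_cons, List.cons.injEq, root] at hw
      simp [ih hw.2, hw.1]
  | node r cs ts =>
    cases w with
    | nil => simp at hw
    | cons c w => simp [root] at hw

theorem leftForest (h : RightForest R ts) (p : List ℕ) :
    RightForest R (PTree.leftForest ts p) := by
  induction p generalizing ts with
  | nil => simpa [PTree.leftForest] using .nil
  | cons i p ih =>
    rcases leftForest_cons (ts := ts) i p with h1 | ⟨r, cs, ts', h1, -, h2⟩
    · rw [h1]
      rw [← List.take_append_drop i ts] at h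
      exact h.left_of_append
    · rw [h2]
      rw [h1] at h
      refine h.append_of_append ?_ fun A hA => ?_
      · cases h.right_of_append with
        | node _ _ _ _ _ hcs => exact ih hcs
      · simpa using .inl (mem_frontierList_leftForest hA)

theorem of_nodeAt (h : RightForest R ts)
    (hR : ∀ p r cs, nodeAt ts p = some (PTree.node r cs) → r ∈ R') : RightForest R' ts := by
  have key {t : PTree T ν} {ts : List (PTree T ν)}
      (hR : ∀ p r cs, nodeAt (t :: ts) p = some (PTree.node r cs) → r ∈ R') :
      ∀ p r cs, nodeAt ts p = some (PTree.node r cs) → r ∈ R' := by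
    rintro (_ | ⟨i, p⟩) r cs h
    · simp at h
    · exact hR _ r cs (nodeAt_cons_succ.trans h)
  induction h with
  | nil => exact .nil
  | leaf X ts _ ih => exact .leaf _ _ (ih (key hR))
  | node r cs ts hr hc _ _ hA ih₁ ih₂ =>
    refine .node r cs ts (hR [0] r cs (by simp [nodeAt])) hc (ih₁ fun p r' cs' h => ?_)
      (ih₂ (key hR)) hA
    exact hR _ r' cs' (nodeAt_node_zero h)

theorem nodeAt_node (h : RightForest R ts) {p : List ℕ} {r : ContextFreeRule T ν}
    (hp : nodeAt ts p = some (PTree.node r cs)) : r ∈ R ∧ cs.map root = r.output := by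
  induction h generalizing p with
  | nil => cases p <;> simp [nodeAt_cons_iff] at hp
  | leaf X ts _ ih =>
    rcases p with _ | ⟨_ | i, p⟩
    · simp at hp
    · simp [nodeAt_cons_iff] at hp
    · exact ih (nodeAt_cons_succ.symm.trans hp)
  | node r cs ts hr hc _ _ _ ih₁ ih₂ =>
    rcases p with _ | ⟨_ | i, p⟩
    · simp at hp
    · rcases nodeAt_cons_iff.1 hp with ⟨rfl, h⟩ | ⟨r', cs', h1, h2⟩
      · simp only [List.getElem?_cons_zero, Option.some.injEq, PTree.node.injEq] at h
        obtain ⟨rfl, rfl⟩ := h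
        exact ⟨hr, hc⟩
      · simp only [List.getElem?_cons_zero, Option.some.injEq, PTree.node.injEq] at h1
        obtain ⟨rfl, rfl⟩ := h1
        exact ih₁ h2
    · exact ih₂ (nodeAt_cons_succ.symm.trans hp)

/-- Interior nodes are ancestors of a given nonterminal leaf or come after it. -/
theorem prefix_or_lt (h : RightForest R ts) {p q : List ℕ} {r : ContextFreeRule T ν} {A : ν}
    (hp : nodeAt ts p = some (PTree.node r cs))
    (hq : nodeAt ts q = some (PTree.leaf (Symbol.nonterminal A))) : p <+: q ∨ q < p := by
  induction h generalizing p q with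
  | nil => cases p <;> simp [nodeAt_cons_iff] at hp
  | leaf X ts _ ih =>
    rcases p with _ | ⟨_ | i, p⟩
    · simp at hp
    · simp [nodeAt_cons_iff] at hp
    · rcases q with _ | ⟨_ | j, q⟩
      · simp at hq
      · exact .inr (List.cons_lt_cons_iff.2 (.inl (Nat.succ_pos _)))
      · have := ih (nodeAt_cons_succ.symm.trans hp) (nodeAt_cons_succ.symm.trans hq)
        simpa [List.cons_lt_cons_iff, List.cons_prefix_cons] using this
  | node r cs ts hr hc _ _ hA ih₁ ih₂ =>
    rcases p with _ | ⟨_ | i, p⟩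
    · simp at hp
    · rcases q with _ | ⟨_ | j, q⟩
      · simp at hq
      · rcases nodeAt_cons_iff.1 hp with ⟨rfl, h⟩ | ⟨r', cs', h1, h2⟩
        · simp
        · rcases nodeAt_cons_iff.1 hq with ⟨rfl, h⟩ | ⟨r'', cs'', h3, h4⟩
          · simp at h
          · simp only [List.getElem?_cons_zero, Option.some.injEq, PTree.node.injEq] at h1 h3
            obtain ⟨rfl, rfl⟩ := h1
            obtain ⟨rfl, rfl⟩ := h3
            simpa [List.cons_lt_cons_iff, List.cons_prefix_cons] using ih₁ h2 h4
      · exact absurd (mem_frontierList_of_nodeAt (nodeAt_cons_succ.symm.trans hq)) (hA A)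
    · rcases q with _ | ⟨_ | j, q⟩
      · simp at hq
      · exact .inr (List.cons_lt_cons_iff.2 (.inl (Nat.succ_pos _)))
      · have := ih₂ (nodeAt_cons_succ.symm.trans hp) (nodeAt_cons_succ.symm.trans hq)
        simpa [List.cons_lt_cons_iff, List.cons_prefix_cons] using this

/-- The leaf at a given position of the yield. -/
theorem exists_leaf (h : RightForest R ts) {u v : List (Symbol T ν)} {X : Symbol T ν}
    (hf : frontierList ts = u ++ X :: v) :
    ∃ p, nodeAt ts p = some (PTree.leaf X) ∧ yieldBefore ts p = u := by
  have key {t : PTree T ν} {ts : List (PTree T ν)} {u : List (Symbol T ν)}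
      (h : ∃ p, nodeAt ts p = some (PTree.leaf X) ∧ yieldBefore ts p = u) :
      ∃ p, nodeAt (t :: ts) p = some (PTree.leaf X) ∧
        yieldBefore (t :: ts) p = frontier t ++ u := by
    obtain ⟨_ | ⟨i, p⟩, h1, rfl⟩ := h
    · simp at h1
    · exact ⟨_, nodeAt_cons_succ.trans h1, by simp [yieldBefore]⟩
  induction h generalizing u v with
  | nil => simp at hf
  | leaf Y ts _ ih =>
    rw [frontierList_cons, frontier_leaf, List.singleton_append] at hf
    cases u with
    | nil =>
      obtain ⟨rfl, -⟩ := List.cons.inj hf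
      exact ⟨[0], by simp [nodeAt], by simp [yieldBefore]⟩
    | cons Z u =>
      simp only [List.cons_append, List.cons.injEq] at hf
      obtain ⟨rfl, hf⟩ := hf
      simpa using key (t := PTree.leaf Y) (ih hf)
  | node r cs ts hr hc _ _ _ ih₁ ih₂ =>
    rw [frontierList_cons, frontier_node] at hf
    rcases append_cons_eq_append hf.symm with ⟨κ, h, -⟩ | ⟨β, rfl, h⟩
    · obtain ⟨p, h1, h2⟩ := ih₁ h
      exact ⟨_, nodeAt_node_zero h1, by simp [yieldBefore, children, h2]⟩
    · simpa using key (t := PTree.node r cs) (ih₂ h)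

end RightForest

/-- Every rightmost derivation has a derivation tree. -/
theorem exists_rightForest {u v : List (Symbol T ν)} (h : RightDerives R u v) :
    ∃ ts, ts.map root = u ∧ RightForest R ts ∧ frontierList ts = v := by
  induction h using Relation.ReflTransGen.head_induction_on with
  | refl =>
    refine ⟨v.map leaf, ?_⟩
    induction v with
    | nil => exact ⟨rfl, .nil, by simp⟩
    | cons X v ih => exact ⟨by simpa [root] using ih.1, .leaf _ _ ih.2.1, by simp [ih.2.2]⟩
  | head hs _ ih =>
    obtain ⟨r, hr, α, w, rfl, rfl⟩ := hs
    obtain ⟨ts, h1, h2, rfl⟩ := ih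
    rw [List.append_assoc] at h1
    obtain ⟨tα, ts, rfl, rfl, h1'⟩ := List.map_eq_append_iff.1 h1
    obtain ⟨tβ, tw, rfl, h3, h4⟩ := List.map_eq_append_iff.1 h1'
    have h5 := h2.right_of_append
    refine ⟨tα ++ node r tβ :: tw, by simp [h4, root], h2.append_of_append
      (.node r tβ tw hr h3 h5.left_of_append h5.right_of_append ?_) ?_, by simp⟩
    · simp [h5.right_of_append.frontierList_of_terminal h4]
    · simp

end PTree

end TLR

namespace TLR

variable {T ν : Type*}

open CFG

/-! ### Counting the reductions before the next shift -/

/-- `Pending eof G a γ n`: with `γ` on the stack and the lookahead `a`, the parser is to make `n`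
reductions before it shifts `a` or, if `a` is the end marker, accepts. -/
inductive Pending (eof : T) (G : CFG T ν) (a : T) : List (Symbol T ν) → ℕ → Prop
  | shift (γ : List (Symbol T ν)) : G.CanRead eof γ (Symbol.terminal a) → Pending eof G a γ 0
  | accept : a = eof → Pending eof G a [Symbol.nonterminal G.start] 0
  | reduce (γ : List (Symbol T ν)) (r : ContextFreeRule T ν) (n : ℕ) : r ∈ G.rules →
      Pending eof G a (γ ++ [Symbol.nonterminal r.input]) n →
      Pending eof G a (γ ++ r.output) (n + 1)

namespace Pending

variable {eof a : T} {G : CFG T ν} {γ : List (Symbol T ν)} {n m : ℕ}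

theorem exists_rightDerives (hP : G.Productive) (h : Pending eof G a γ n) :
    ∃ w : List T, RightDerives ↑G.rules [Symbol.nonterminal G.start]
      (γ ++ w.map Symbol.terminal) ∧ w.headD eof = a := by
  induction h with
  | shift γ h => exact (h.sentential hP).2
  | accept h => exact ⟨[], .refl, h.symm⟩
  | reduce γ r n hr _ ih =>
    obtain ⟨w, hw, ha⟩ := ih
    exact ⟨w, (by simpa using hw : RightDerives _ _ _).trans (.rule hr γ w), ha⟩

theorem action_eq_reduce (hL : G.IsLR1) (hW : G.WellFormed eof) (hP : G.Productive)
    {r : ContextFreeRule T ν} (hr : r ∈ G.rules)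
    (h : Pending eof G a (γ ++ [Symbol.nonterminal r.input]) n) :
    G.action (G.stateOf eof (γ ++ r.output)) a = .reduce r := by
  obtain ⟨w, hw, rfl⟩ := h.exists_rightDerives hP
  exact CFG.action_eq_reduce hL hW hP (.production γ r w hr (by simpa using hw))

/-- In an LR(1) grammar the number of pending reductions is determined. -/
theorem unique (hL : G.IsLR1) (hW : G.WellFormed eof) (hP : G.Productive)
    (h : Pending eof G a γ n) (h' : Pending eof G a γ m) : n = m := by
  have hact : ∀ {γ n}, Pending eof G a γ n → (n = 0 ∧
      (G.action (G.stateOf eof γ) a = .shift ∨ G.action (G.stateOf eof γ) a = .accept)) ∨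
      ∃ α r k, γ = α ++ r.output ∧ n = k + 1 ∧ G.action (G.stateOf eof γ) a = .reduce r ∧
        Pending eof G a (α ++ [Symbol.nonterminal r.input]) k := by
    intro γ n h
    cases h with
    | shift γ h => exact .inl ⟨rfl, .inl (action_eq_shift_iff.2 h)⟩
    | accept h => exact .inl ⟨rfl, .inr ((action_eq_accept_iff hW).2 ⟨rfl, h⟩)⟩
    | reduce γ r n hr h => exact .inr ⟨γ, r, n, rfl, rfl, h.action_eq_reduce hL hW hP hr, h⟩
  induction n generalizing γ m with
  | zero =>
    rcases hact h with ⟨-, h1⟩ | ⟨α, r, k, -, h1, -⟩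
    · rcases hact h' with ⟨rfl, -⟩ | ⟨α, r, k, -, -, h2, -⟩
      · rfl
      · simp [h2] at h1
    · simp at h1
  | succ n ih =>
    rcases hact h with ⟨h1, -⟩ | ⟨α, r, k, rfl, h1, h2, h3⟩
    · simp at h1
    · obtain rfl := Nat.succ.inj h1
      rcases hact h' with ⟨-, h1⟩ | ⟨α', r', k', h4, rfl, h5, h6⟩
      · simp [h2] at h1
      · obtain rfl := Action.reduce.inj (h2.symm.trans h5)
        obtain rfl := List.append_cancel_right h4
        rw [ih h3 h6]

open PTree in
/-- The parser reduces the yield of a forest to the roots, with one reduction for every interior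
node, if no terminal has to be shifted on the way. -/
theorem of_rightForest {ts : List (PTree T ν)} (hts : RightForest ↑G.rules ts)
    (hf : ∀ κ c, frontierList ts ≠ κ ++ [Symbol.terminal c])
    (h : Pending eof G a (γ ++ ts.map root) n) :
    Pending eof G a (γ ++ frontierList ts) (n + forestSize ts) := by
  induction hts generalizing γ n with
  | nil => simpa [forestSize] using h
  | leaf X ts _ ih =>
    have := ih (γ := γ ++ [X]) (fun κ c h => hf (X :: κ) c (by simp [h]))
      (by simpa [root] using h)
    simpa [forestSize, size] using this
  | node r cs ts hr hc _ _ hA ih₁ ih₂ =>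
    have hnil : frontierList ts = [] := by
      rcases List.eq_nil_or_concat (frontierList ts) with h | ⟨κ, X | A, h⟩
      · exact h
      · exact absurd (by simp [h]) (hf (frontierList cs ++ κ) X)
      · exact absurd (by simp [h]) (hA A)
    have h1 := ih₂ (γ := γ ++ [Symbol.nonterminal r.input]) (by simp [hnil])
      (by simpa [root] using h)
    rw [hnil, List.append_nil] at h1
    have h2 := Pending.reduce γ r _ hr h1
    rw [← hc] at h2
    have h3 := ih₁ (fun κ c h => hf κ c (by simp [h, hnil])) h2
    have e : n + forestSize ts + 1 + forestSize cs = n + (forestSize cs + 1 + forestSize ts) := by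
      omega
    simpa [forestSize, size, hnil, e] using h3

end Pending

/-! ### The conservation function -/

open PTree

/-- The grammar `G'` keeps of every production that occurs in the tree at least the part that the
number of that occurrence asks for. -/
def KeepsNodes (G' : CFG T ν) (ts : List (PTree T ν)) (b a : List ℕ) : Prop :=
  ∀ p π cs, nodeAt ts p = some (.node π cs) → 0 ≤ nodeNumber b a p cs.length →
    ∃ φ ∈ G'.rules, φ.input = π.input ∧
      π.output.take (nodeNumber b a p cs.length).toNat <+: φ.output ∧
      (nodeNumber b a p cs.length = cs.length + 1 → φ = π)

theorem nodeNumber_le {ts : List (PTree T ν)} {b a p : List ℕ} {π : ContextFreeRule T ν}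
    {cs : List (PTree T ν)} {X : Symbol T ν} (ha : nodeAt ts a = some (.leaf X))
    (hp : nodeAt ts p = some (.node π cs)) : nodeNumber b a p cs.length ≤ cs.length + 1 := by
  unfold nodeNumber
  split_ifs with h
  · obtain ⟨⟨q, rfl⟩, hne⟩ := h
    rcases q with _ | ⟨k, q⟩
    · simp at hne
    have := nodeAt_append_path hp ha (by simp)
    have hk : k < cs.length := by
      by_contra hk
      simp_all [nodeAt_cons_iff]
    have hk' : (p ++ k :: q).getD p.length 0 = k := by simp [List.getD]
    rw [hk']
    omega
  all_goals omega

/-- The maximum in the conservation function is attained or exceeded for every single node. -/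
theorem KeepsNodes.of_conserves {eof : T} {G G' : CFG T ν} {α : List (Symbol T ν)} {B : ν} {a : T}
    {x : List T} {ts : List (PTree T ν)} {b a' : List ℕ}
    (hts : IsSententialTree eof G α B a x ts b a') (hrf : RightForest ↑G.rules ts)
    (h : Conserves eof G ↑G'.rules α B a x) : KeepsNodes G' ts b a' := by
  intro p π cs hp hN
  obtain ⟨hπ, hcs⟩ := hrf.nodeAt_node hp
  have hlen : cs.length = π.output.length := by rw [← hcs, List.length_map]
  have hub : (π.output.length : ℤ) + 1 ∈ upperBounds (insert (-1) {v | ∃ p cs,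
      nodeAt ts p = some (PTree.node π cs) ∧ v = nodeNumber b a' p cs.length}) := by
    rintro v (rfl | ⟨p', cs', hp', rfl⟩)
    · omega
    · have hlen' : cs'.length = π.output.length := by
        rw [← (hrf.nodeAt_node hp').2, List.length_map]
      simpa [hlen'] using nodeNumber_le (b := b) hts.nodeA hp'
  have hV : nodeNumber b a' p cs.length ≤ conservation ts b a' π :=
    le_csSup ⟨_, hub⟩ (.inr ⟨p, cs, hp, rfl⟩)
  obtain ⟨φ, hφ, ⟨h1, h2, h3⟩ | ⟨-, rfl⟩⟩ := h ts b a' hts π hπ (by omega)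
  · refine ⟨φ, hφ, h2.symm, List.IsPrefix.trans ?_ h3, fun h4 => by omega⟩
    exact List.take_prefix_take_left (by omega)
  · exact ⟨π, hφ, rfl, List.take_prefix _ _, fun _ => rfl⟩

/-- The productions on the path from the root to the leaf `a` lead the parser to an item with the
dot before `a`; only the parts of the right sides up to the path matter. -/
theorem canRead_leftForest {eof : T} {G : CFG T ν} (hP : G.Productive) {c : T} {p : List ℕ} {i : ℕ}
    {ts : List (PTree T ν)} {δ bf af : List (Symbol T ν)} {A : Option ν} {l : T}
    (hleaf : nodeAt ts (i :: p) = some (.leaf (Symbol.terminal c)))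
    (hi : G.ItemReach eof δ ⟨A, bf, af, l⟩) (haf : (ts.map root).take (i + 1) <+: af)
    (hsp : ∀ q k s π cs, i :: p = q ++ k :: s → nodeAt ts q = some (.node π cs) →
      ∃ φ ∈ G.rules, φ.input = π.input ∧ π.output.take (k + 1) <+: φ.output)
    (hroot : ∀ q π cs, nodeAt ts q = some (.node π cs) → cs.map root = π.output) :
    G.CanRead eof (δ ++ (leftForest ts (i :: p)).map root) (Symbol.terminal c) := by
  induction p generalizing i ts δ bf af A l with
  | nil =>
    obtain ⟨-, h1⟩ | ⟨_, _, -, h1⟩ := nodeAt_cons_iff.1 hleaf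
    · obtain ⟨β, hβ⟩ := haf
      rw [List.take_add_one] at hβ
      simp only [List.getElem?_map, h1, Option.map_some, Option.toList_some, root,
        List.append_assoc, List.singleton_append] at hβ
      rw [← hβ] at hi
      exact ⟨_, by simpa [leftForest, h1, children] using hi.shiftAll, β, rfl⟩
    · simp at h1
  | cons k p ih =>
    obtain ⟨h, -⟩ | ⟨r, cs, h1, h2⟩ := nodeAt_cons_iff.1 hleaf
    · simp at h
    · obtain ⟨β, hβ⟩ := haf
      rw [List.take_add_one] at hβ
      simp only [List.getElem?_map, h1, Option.map_some, Option.toList_some, root,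
        List.append_assoc, List.singleton_append] at hβ
      rw [← hβ] at hi
      have h3 := hi.shiftAll
      have h4 : nodeAt ts [i] = some (.node r cs) := by simpa [nodeAt] using h1
      obtain ⟨φ, hφ, h5, h6⟩ := hsp [i] k p r cs rfl h4
      obtain ⟨x, hx⟩ := h3.exists_terminal hP rfl
      have h7 := ItemReach.closure _ _ φ β _ h3 (by rw [h5]) hφ
        (mem_first_append_terminal.2 ⟨x, hx, rfl⟩)
      have h8 := ih h2 h7 (by rwa [hroot _ _ _ h4])
        (fun q k' s π cs' he hq => hsp (i :: q) k' s π cs' (by rw [he]; rfl)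
          (nodeAt_cons_iff.2 (.inr ⟨r, cs, h1, hq⟩)))
        (fun q π cs' hq => hroot (i :: q) π cs' (nodeAt_cons_iff.2 (.inr ⟨r, cs, h1, hq⟩)))
      simpa [leftForest, h1, children] using h8

/-- A grammar that keeps the nodes of the tree has as many pending reductions as there are interior
nodes between `B` and `a`. -/
theorem Pending.of_keepsNodes {eof : T} {G G' : CFG T ν} (hP : G'.Productive)
    (hS : G'.start = G.start) {α : List (Symbol T ν)} {B : ν} {a : T}
    {x : List T} {ts : List (PTree T ν)} {b a' : List ℕ}
    (hts : IsSententialTree eof G α B a x ts b a') (hrf : RightForest ↑G.rules ts)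
    (h : KeepsNodes G' ts b a') :
    Pending eof G' a (α ++ [Symbol.nonterminal B]) (forestSize (leftForest ts a')) := by
  have hL : RightForest ↑G'.rules (leftForest ts a') := by
    refine (hrf.leftForest a').of_nodeAt fun p π cs hp => ?_
    obtain ⟨q, h1, h2, h3⟩ := exists_nodeAt_of_leftForest hp
    have h4 : nodeNumber b a' q cs.length = cs.length + 1 := by
      unfold nodeNumber
      rw [if_neg fun h => h3 h.1]
      split_ifs with h4 h5
      · rfl
      · rfl
      · exfalso
        rcases hts.rightmost q π cs h1 with h6 | h6
        · refine h4 ⟨h6, ?_⟩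
          rintro rfl
          simpa [h1] using hts.nodeB
        · exact h5 ⟨h6, h2⟩
    obtain ⟨φ, hφ, -, -, h5⟩ := h q π cs h1 (by omega)
    exact h5 h4 ▸ hφ
  have hfr : frontierList (leftForest ts a') = α ++ [Symbol.nonterminal B] := by
    rw [frontierList_leftForest, hts.beforeA]
  have key : Pending eof G' a ([] ++ (leftForest ts a').map root) 0 := by
    obtain ⟨t, h1, -, rfl⟩ := hts.top
    have hleaf := hts.nodeA
    rcases a' with _ | ⟨_ | _ | i, p⟩
    · simp at hleaf
    · refine .shift _ (canRead_leftForest hP hleaf .init (by simp [h1, hS]) ?_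
        fun q π cs hq => (hrf.nodeAt_node hq).2)
      intro q k s π cs he hq
      have h2 : nodeNumber b (0 :: p) q cs.length = k + 1 := by
        unfold nodeNumber
        rw [if_pos ⟨⟨k :: s, he.symm⟩, by rw [he]; simp⟩, he]
        simp [List.getD]
      obtain ⟨φ, hφ, h3, h4, -⟩ := h q π cs hq (by omega)
      rw [h2] at h4
      exact ⟨φ, hφ, h3, h4⟩
    · obtain ⟨rfl, h2⟩ | ⟨_, _, h2, -⟩ := nodeAt_cons_iff.1 hleaf
      · have : eof = a := by simpa using h2
        simpa [leftForest, children, h1, hS] using Pending.accept (G := G') this.symm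
      · simp at h2
    · simp [nodeAt_cons_iff] at hleaf
  have := key.of_rightForest hL (by
    intro κ c hκ
    rw [hfr] at hκ
    simpa using (List.append_inj' hκ rfl).2)
  simpa [hfr] using this

theorem Transformation.apply_id (G : CFG T ν) :
    (⟨∅, ∅, ∅⟩ : Transformation T ν).apply G = G := by
  simp [Transformation.apply]

/-- A valid transformation does not change the number of pending reductions. This is what validity
contributes to the theorem: without it, transformations could go on forever between two shifts. -/
theorem exists_pending {eof : T} {G : CFG T ν} (hP : G.Productive) {α : List (Symbol T ν)} {B : ν}
    {w : List T} (h : RightDerives ↑G.rules [Symbol.nonterminal G.start]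
      (α ++ Symbol.nonterminal B :: w.map Symbol.terminal)) :
    ∃ n, Pending eof G (w.headD eof) (α ++ [Symbol.nonterminal B]) n ∧
      ∀ Δ : Transformation T ν, (Δ.apply G).Productive → Δ.ValidFor eof G α B (w.headD eof) →
        Pending eof (Δ.apply G) (w.headD eof) (α ++ [Symbol.nonterminal B]) n := by
  obtain ⟨x, hx⟩ := (sentential_cons_iff (eof := eof) (G := G) (α ++ [Symbol.nonterminal B])
    (w.headD eof)).2 ⟨w, by simpa using h, rfl⟩
  simp only [List.append_assoc, List.singleton_append] at hx
  generalize w.headD eof = a at hx ⊢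
  obtain ⟨ts, h1, h2, h3⟩ := exists_rightForest hx
  obtain ⟨b, hb, hb'⟩ := h2.exists_leaf h3
  obtain ⟨a', ha, ha'⟩ := h2.exists_leaf (u := α ++ [Symbol.nonterminal B])
    (X := Symbol.terminal a) (v := x.map Symbol.terminal) (by simp [h3])
  have hts : IsSententialTree eof G α B a x ts b a' := by
    refine ⟨?_, h3, hb, hb', ha, ha', fun p r cs hp => h2.prefix_or_lt hp hb⟩
    obtain ⟨t, ts, rfl, h4, h5⟩ := List.map_eq_cons_iff.1 h1
    obtain ⟨t', ts, rfl, h5, h6⟩ := List.map_eq_cons_iff.1 h5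
    obtain rfl := List.map_eq_nil_iff.1 h6
    refine ⟨t, h4, h2.isDerivation t (by simp), ?_⟩
    cases t' with
    | leaf X => simpa [root] using h5
    | node r cs => simp [root] at h5
  have hself : KeepsNodes G ts b a' := fun p π cs hp _ =>
    ⟨π, (h2.nodeAt_node hp).1, rfl, List.take_prefix _ _, fun _ => rfl⟩
  refine ⟨_, .of_keepsNodes hP rfl hts h2 hself, fun Δ hΔ hv => ?_⟩
  obtain ⟨-, -, rfl | hv⟩ := hv
  · rw [Transformation.apply_id]
    exact .of_keepsNodes hP rfl hts h2 hself
  · exact .of_keepsNodes (G := G) hΔ rfl hts h2 (.of_conserves hts h2 (hv x hx))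

end TLR

namespace TLR

variable {T ν C : Type*} {E : Coding T ν C}

open CFG

namespace Grammar

variable {eof : T} {G : Grammar E}

/-! ### Steps of the parsing algorithm -/

/-- One step of the parsing algorithm that does not end it. -/
def Next (eof : T) (G : Grammar E) (c c' : ParserState G.M.Γ₂ T ν) : Prop :=
  G.parserStep eof c = .inl c'

/-- Started in the state `c`, the parsing algorithm halts and returns `e`. -/
def ReturnsFrom (eof : T) (G : Grammar E) (c : ParserState G.M.Γ₂ T ν) (e : Bool) : Prop :=
  ∃ c', Relation.ReflTransGen (G.Next eof) c c' ∧ G.parserStep eof c' = .inr e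

theorem ReturnsFrom.unique {c : ParserState G.M.Γ₂ T ν} {e e' : Bool}
    (h : G.ReturnsFrom eof c e) (h' : G.ReturnsFrom eof c e') : e = e' := by
  obtain ⟨d, hd, he⟩ := h
  obtain ⟨d', hd', he'⟩ := h'
  have hend : ∀ {d e}, G.parserStep eof d = .inr e → ∀ f, ¬ G.Next eof d f := by
    intro d e h f hf
    rw [Next, h] at hf
    simp at hf
  have hdd := eq_of_reflTransGen_of_terminal (fun a b c hb hc => Sum.inl.inj (hb.symm.trans hc))
    hd hd' (hend he) (hend he')
  subst hdd
  exact Sum.inr.inj (he.symm.trans he')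

theorem ReturnsFrom.head {c c' : ParserState G.M.Γ₂ T ν} {e : Bool}
    (h : Relation.ReflTransGen (G.Next eof) c c') (h' : G.ReturnsFrom eof c' e) :
    G.ReturnsFrom eof c e := by
  obtain ⟨d, hd, he⟩ := h'
  exact ⟨d, h.trans hd, he⟩

/-- One step of the parser, by the entry of the action table. -/
theorem parserStep_eq {c : ParserState G.M.Γ₂ T ν} {γ : List (Symbol T ν)} {a : T} {rest : List T}
    (hs : IsStack eof c.cfg γ c.stack) (hi : c.input = a :: rest) :
    G.parserStep eof c = match c.cfg.action (c.cfg.stateOf eof γ) a with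
      | .shift =>
        match Stack.pushSymbol c.cfg (Symbol.terminal a) c.stack with
        | some σ => .inl ⟨c.cfg, σ, rest, c.shifted ++ [a], c.memory⟩
        | none => .inr false
      | .reduce r =>
        match G.reduceStep eof c r a with
        | some c' => .inl c'
        | none => .inr false
      | .accept => .inr true
      | .error => .inr false := by
  obtain ⟨H, τ, i, y, u⟩ := c
  change IsStack eof H γ τ at hs
  obtain ⟨Y, σ, rfl⟩ := hs.eq_cons
  obtain rfl : i = a :: rest := hi
  rfl

theorem next_shift {H : CFG T ν} {γ : List (Symbol T ν)} {σ : Stack T ν} {a : T} {z y : List T}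
    {u : List G.M.Γ₂} (hs : IsStack eof H γ σ) (h : H.CanRead eof γ (Symbol.terminal a)) :
    ∃ σ', IsStack eof H (γ ++ [Symbol.terminal a]) σ' ∧
      G.Next eof ⟨H, σ, a :: z, y, u⟩ ⟨H, σ', z, y ++ [a], u⟩ := by
  obtain ⟨σ', h1, h2⟩ := hs.exists_pushSymbol h
  refine ⟨σ', h2, ?_⟩
  have hact : H.action (H.stateOf eof γ) a = .shift := action_eq_shift_iff.2 h
  rw [Next, parserStep_eq hs rfl]
  simp only [hact, h1]

/-- The parser shifts a string of terminals if the whole string can be read. -/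
theorem shifts {H : CFG T ν} {γ : List (Symbol T ν)} {σ : Stack T ν} {v z y : List T}
    {u : List G.M.Γ₂} (hs : IsStack eof H γ σ)
    (h : H.Readable eof (γ ++ v.map Symbol.terminal)) :
    ∃ σ', IsStack eof H (γ ++ v.map Symbol.terminal) σ' ∧
      Relation.ReflTransGen (G.Next eof) ⟨H, σ, v ++ z, y, u⟩ ⟨H, σ', z, y ++ v, u⟩ := by
  induction v generalizing γ σ y with
  | nil => exact ⟨σ, by simpa using hs, by simpa using .refl⟩
  | cons a v ih =>
    obtain ⟨σ₁, h1, h2⟩ := next_shift (G := G) (z := v ++ z) (y := y) (u := u) hs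
      (h γ (Symbol.terminal a) (v.map Symbol.terminal) (by simp))
    obtain ⟨σ₂, h3, h4⟩ := ih (y := y ++ [a]) h1 (by simpa using h)
    exact ⟨σ₂, by simpa using h3, .head h2 (by simpa using h4)⟩

theorem IsTLR.action_eq_reduce {H : CFG T ν} (hH : (G.withCFG H).IsTLR eof)
    {α : List (Symbol T ν)} {r : ContextFreeRule T ν} {w : List T} (hr : r ∈ H.rules)
    (h : RightDerives ↑H.rules [Symbol.nonterminal H.start]
      (α ++ Symbol.nonterminal r.input :: w.map Symbol.terminal)) :
    H.action (H.stateOf eof (α ++ r.output)) (w.headD eof) = .reduce r :=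
  CFG.action_eq_reduce hH.2.2.1 hH.1 hH.2.1 (.production α r w hr h)

theorem append_eof_eq (z : List T) : ∃ rest, z ++ [eof] = z.headD eof :: rest := by
  cases z <;> simp

theorem nontransDerives_mono {H : CFG T ν} {u v : List (Symbol T ν)}
    (h : (G.withCFG H).NontransDerives u v) : RightDerives ↑H.rules u v :=
  RightDerives.mono (fun _ hr => hr.1) h

/-- The step of the parser at the end of the handle of a nontransformative production. -/
theorem next_reduce {H : CFG T ν} (hH : (G.withCFG H).IsTLR eof) {α : List (Symbol T ν)}
    {σ : Stack T ν} {r : ContextFreeRule T ν} {w z y : List T} {u : List G.M.Γ₂}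
    (hs : IsStack eof H (α ++ r.output) σ) (hr : r ∈ H.rules) (hrt : r ∉ G.trans)
    (h : RightDerives ↑H.rules [Symbol.nonterminal H.start]
      (α ++ Symbol.nonterminal r.input :: w.map Symbol.terminal))
    (hw : w.headD eof = z.headD eof) :
    ∃ σ', IsStack eof H (α ++ [Symbol.nonterminal r.input]) σ' ∧
      G.Next eof ⟨H, σ, z ++ [eof], y, u⟩ ⟨H, σ', z ++ [eof], y, u⟩ := by
  obtain ⟨σ', h1, h2⟩ := hs.drop.exists_pushSymbol (X := Symbol.nonterminal r.input)
    (canRead_of_rightDerives h α _ _ rfl ⟨_, List.mem_cons_self⟩)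
  obtain ⟨rest, hz⟩ := append_eof_eq (eof := eof) z
  refine ⟨σ', h2, ?_⟩
  rw [Next, parserStep_eq hs hz]
  simp only [← hw, hH.action_eq_reduce hr h, reduceStep, if_neg hrt, h1, Option.map_some]

/-- The step of the parser at the end of the handle of a transformative production. -/
theorem next_transform {H : CFG T ν} (hH : (G.withCFG H).IsTLR eof) {Δ : Transformation T ν}
    (hΔ : (G.withCFG (Δ.apply H)).IsTLR eof) {α : List (Symbol T ν)}
    {σ : Stack T ν} {r : ContextFreeRule T ν} {w z y : List T} {u u' : List G.M.Γ₂}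
    (hs : IsStack eof H (α ++ r.output) σ) (hr : r ∈ H.rules) (hrt : r ∈ G.trans)
    (h : RightDerives ↑H.rules [Symbol.nonterminal H.start]
      (α ++ Symbol.nonterminal r.input :: w.map Symbol.terminal))
    (hw : w.headD eof = z.headD eof) (ho : G.M.Outputs y u H u' Δ)
    (hv : Δ.ValidFor eof H α r.input (z.headD eof))
    (hvp : (Δ.apply H).ViablePrefix (α ++ [Symbol.nonterminal r.input])) :
    ∃ σ', IsStack eof (Δ.apply H) (α ++ [Symbol.nonterminal r.input]) σ' ∧
      G.Next eof ⟨H, σ, z ++ [eof], y, u⟩ ⟨Δ.apply H, σ', z ++ [eof], [], u'⟩ := by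
  have hread := hvp.readable (eof := eof)
  obtain ⟨τ, h1, h2⟩ := (IsStack.initial (eof := eof) (G := Δ.apply H)).exists_pushAll (α := α)
    fun α₁ X α₂ he => hread α₁ X (α₂ ++ [Symbol.nonterminal r.input]) (by simp [he])
  obtain ⟨σ', h3, h4⟩ := h2.exists_pushSymbol (X := Symbol.nonterminal r.input)
    (hread α _ [] rfl)
  obtain ⟨rest, hz⟩ := append_eof_eq (eof := eof) z
  refine ⟨σ', h4, ?_⟩
  have ho' : ∃ o : List G.M.Γ₂ × Transformation T ν, G.M.Outputs y u H o.1 o.2 := ⟨(u', Δ), ho⟩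
  have hc : ho'.choose = (u', Δ) := by
    obtain ⟨e1, e2⟩ := ho'.choose_spec.unique ho
    exact Prod.ext e1 e2
  have ht : G.transformStack eof H (σ.drop r.output.length) r.input (z.headD eof) y u =
      some (Δ.apply H, τ, u') := by
    unfold transformStack
    rw [dif_pos ho', hc, hs.drop.symbols_eq, if_pos ⟨hv, hΔ⟩, h1]
    rfl
  have hact := hH.action_eq_reduce hr h
  rw [hw] at hact
  rw [Next, parserStep_eq hs hz]
  simp only [hact, reduceStep, if_pos hrt, ht, Option.bind_some, h3, Option.map_some]

/-- The parser traces a nontransformative derivation backwards. The sentential form that makes the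
stack viable may continue with a string `w` other than the unread input `z`; only the lookahead has
to be the same. -/
theorem run {H : CFG T ν} (hH : (G.withCFG H).IsTLR eof) {κ ζ : List (Symbol T ν)} {w z : List T}
    {u : List G.M.Γ₂} (hκ : H.Readable eof κ)
    (hw : w.headD eof = z.headD eof)
    (hd : RightDerives ↑H.rules [Symbol.nonterminal H.start] (κ ++ w.map Symbol.terminal))
    (h : (G.withCFG H).NontransDerives κ ζ) :
    ∀ (α : List (Symbol T ν)) (σ : Stack T ν) (v y : List T),
      (α = [] ∨ ∃ α' B, α = α' ++ [Symbol.nonterminal B]) → ζ = α ++ v.map Symbol.terminal →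
      IsStack eof H α σ → ∃ σ', IsStack eof H κ σ' ∧
        Relation.ReflTransGen (G.Next eof) ⟨H, σ, v ++ (z ++ [eof]), y, u⟩
          ⟨H, σ', z ++ [eof], y ++ v, u⟩ := by
  induction h with
  | refl =>
    rintro α σ v y - rfl hs
    exact shifts hs hκ
  | @tail _ _ hκζ hs ih =>
    obtain ⟨r, hr, α₁, w₁, rfl, rfl⟩ := hs
    intro α σ v y hα hv hs
    -- the symbols of `α` cannot reach into the terminal suffix `w₁`
    obtain ⟨v₁, rfl, hv₁⟩ : ∃ v₁, v = v₁ ++ w₁ ∧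
        α₁ ++ r.output = α ++ v₁.map Symbol.terminal := by
      rcases List.append_eq_append_iff.1 hv with ⟨c, rfl, h2⟩ | ⟨c, h1, h2⟩
      · rcases hα with hα | ⟨α', B, hα⟩
        · simp only [List.append_eq_nil_iff] at hα
          obtain ⟨⟨rfl, hr0⟩, rfl⟩ := hα
          refine ⟨[], ?_, by simp [hr0]⟩
          simpa using (map_terminal_inj (by simpa using h2)).symm
        · rcases List.eq_nil_or_concat' c with rfl | ⟨c', X, rfl⟩
          · refine ⟨[], ?_, by simp⟩
            simpa using (map_terminal_inj (by simpa using h2)).symm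
          · rw [← List.append_assoc] at hα
            obtain rfl : X = Symbol.nonterminal B := by simpa using (List.append_inj' hα rfl).2
            exact absurd (h2 ▸ by simp : Symbol.nonterminal B ∈ w₁.map Symbol.terminal)
              not_nonterminal_mem_map
      · obtain ⟨v₁, v₂, rfl, rfl, h3⟩ := List.map_eq_append_iff.1 h2
        exact ⟨v₁, by rw [map_terminal_inj h3], h1⟩
    have hd' : RightDerives ↑H.rules [Symbol.nonterminal H.start]
        (α₁ ++ Symbol.nonterminal r.input :: (w₁ ++ w).map Symbol.terminal) := by
      have := hd.trans ((nontransDerives_mono hκζ).append_right w)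
      simpa using this
    have hlast : H.LastStep α₁ (some r.input) r.output (w₁ ++ w) := .production α₁ r _ hr.1 hd'
    obtain ⟨σ₁, h1, h2⟩ := shifts (G := G) (v := v₁) (z := w₁ ++ (z ++ [eof])) (y := y) (u := u) hs
      (hv₁ ▸ hlast.readable)
    rw [← hv₁] at h1
    obtain ⟨σ₂, h3, h4⟩ := next_reduce (G := G) (z := w₁ ++ z) (y := y ++ v₁) (u := u) hH h1 hr.1
      hr.2 hd' (by cases w₁ with | nil => exact hw | cons => rfl)
    obtain ⟨σ₃, h5, h6⟩ := ih (α₁ ++ [Symbol.nonterminal r.input]) σ₂ w₁ (y ++ v₁)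
      (.inr ⟨_, _, rfl⟩) (by simp) h3
    refine ⟨σ₃, h5, ?_⟩
    simp only [List.append_assoc] at h2 h4 h6 ⊢
    exact h2.trans (.head h4 h6)

/-! ### The parser accepts the language -/

theorem returnsFrom_accept {H : CFG T ν} (hH : (G.withCFG H).IsTLR eof) {σ : Stack T ν} {y : List T}
    {u : List G.M.Γ₂} (hs : IsStack eof H [Symbol.nonterminal H.start] σ) :
    G.ReturnsFrom eof ⟨H, σ, [eof], y, u⟩ true := by
  have hact : H.action (H.stateOf eof [Symbol.nonterminal H.start]) eof = .accept :=
    (action_eq_accept_iff hH.1).2 ⟨rfl, rfl⟩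
  refine ⟨_, .refl, ?_⟩
  rw [parserStep_eq hs rfl]
  simp only [hact]

/-- The parser follows a chain of valid semiparses that ends in `S`. -/
theorem returnsFrom_of_transGen {f e : Form G.M.Γ₂ T ν}
    (h : Relation.TransGen (G.ValidSemiparse eof) f e)
    (he : e.processed = [Symbol.nonterminal G.cfg.start]) (he' : e.unread = [])
    (hf : f.processed = [] ∨ ∃ α' B, f.processed = α' ++ [Symbol.nonterminal B])
    (hS : f.cfg.start = G.cfg.start) {σ : Stack T ν} (hs : IsStack eof f.cfg f.processed σ) :
    G.ReturnsFrom eof ⟨f.cfg, σ, f.unread ++ [eof], [], f.memory⟩ true := by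
  -- a single semiparse either ends in acceptance or is simulated by the parser
  have key : ∀ {f f' : Form G.M.Γ₂ T ν} {σ : Stack T ν}, G.ValidSemiparse eof f f' →
      (f.processed = [] ∨ ∃ α' B, f.processed = α' ++ [Symbol.nonterminal B]) →
      IsStack eof f.cfg f.processed σ →
      G.ReturnsFrom eof ⟨f.cfg, σ, f.unread ++ [eof], [], f.memory⟩ true ∨
      ((G.withCFG f'.cfg).IsTLR eof ∧ f'.cfg.start = f.cfg.start ∧
        (∃ α' B, f'.processed = α' ++ [Symbol.nonterminal B]) ∧
        ∃ σ', IsStack eof f'.cfg f'.processed σ' ∧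
          Relation.ReflTransGen (G.Next eof) ⟨f.cfg, σ, f.unread ++ [eof], [], f.memory⟩
            ⟨f'.cfg, σ', f'.unread ++ [eof], [], f'.memory⟩) := by
    intro f f' σ h hf hs
    cases h with
    | final α x u w H hH hd =>
      left
      obtain ⟨σ', h1, h2⟩ := run (G := G) (w := []) (z := []) (u := u) hH
        (CFG.LastStep.augmented.readable) rfl .refl hd α σ x [] hf rfl hs
      exact .head h2 (returnsFrom_accept hH h1)
    | transform α β' r y z u w H Δ hH hΔ hr hrt hd hvf ho hv =>
      right
      obtain ⟨v, hv1, hv2⟩ := (sentential_cons_iff _ _).1 hv.2.1.2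
      simp only [List.append_assoc, List.singleton_append] at hv1
      have hd' : (G.withCFG H).NontransDerives (β' ++ r.output) (α ++ y.map Symbol.terminal) := by
        refine RightDerives.of_append_right' (x := z) ?_
        simpa [NontransDerives] using hd
      obtain ⟨σ₁, h1, h2⟩ := run (G := G) (w := v) (z := z) (u := u) hH
        (LastStep.readable (.production β' r v hr hv1)) hv2
        (LastStep.rightDerives (.production β' r v hr hv1)) hd' α σ y [] hf rfl hs
      obtain ⟨σ₂, h3, h4⟩ := next_transform hH hΔ h1 hr hrt hv1 hv2 ho hv hvf.1
      refine ⟨hΔ, rfl, ⟨_, _, rfl⟩, σ₂, h3, ?_⟩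
      simpa using h2.tail h4
  induction h using Relation.TransGen.head_induction_on generalizing σ with
  | single h =>
    rcases key h hf hs with h1 | ⟨h1, h2, -, σ', h3, h4⟩
    · exact h1
    · refine .head h4 ?_
      rw [he, ← hS, ← h2] at h3
      rw [he']
      exact returnsFrom_accept h1 h3
  | head h _ ih =>
    rcases key h hf hs with h1 | ⟨-, h2, h3, σ', h4, h5⟩
    · exact h1
    · exact .head h5 (ih (.inr h3) (h2.trans hS) h4)

/-! ### Accepted strings belong to the language -/

/-- The effect of a reduction. -/
theorem reduceStep_eq_some {c c' : ParserState G.M.Γ₂ T ν} {r : ContextFreeRule T ν} {a : T}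
    {α : List (Symbol T ν)} (hs : IsStack eof c.cfg (α ++ r.output) c.stack)
    (h : G.reduceStep eof c r a = some c') :
    IsStack eof c'.cfg (α ++ [Symbol.nonterminal r.input]) c'.stack ∧ c'.input = c.input ∧
      ((r ∉ G.trans ∧ c'.cfg = c.cfg ∧ c'.shifted = c.shifted ∧ c'.memory = c.memory) ∨
        (r ∈ G.trans ∧ c'.shifted = [] ∧ ∃ Δ : Transformation T ν, c'.cfg = Δ.apply c.cfg ∧
          G.M.Outputs c.shifted c.memory c.cfg c'.memory Δ ∧
          Δ.ValidFor eof c.cfg α r.input a ∧ (G.withCFG (Δ.apply c.cfg)).IsTLR eof)) := by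
  unfold reduceStep at h
  split_ifs at h with hrt
  · obtain ⟨⟨H, σ, u⟩, h1, h2⟩ := Option.bind_eq_some_iff.1 h
    obtain ⟨σ', h3, rfl⟩ := Option.map_eq_some_iff.1 h2
    unfold transformStack at h1
    split_ifs at h1 with ho hv
    rw [hs.drop.symbols_eq] at h1 hv
    obtain ⟨τ, h4, h5⟩ := Option.map_eq_some_iff.1 h1
    simp only [Prod.mk.injEq] at h5
    obtain ⟨rfl, rfl, rfl⟩ := h5
    have h6 : IsStack eof _ ([] ++ α) τ := IsStack.initial.of_pushAll h4
    exact ⟨h6.of_pushSymbol h3, rfl, .inr ⟨hrt, rfl, _, rfl, ho.choose_spec, hv⟩⟩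
  · obtain ⟨σ', h3, rfl⟩ := Option.map_eq_some_iff.1 h
    exact ⟨hs.drop.of_pushSymbol h3, rfl, .inl ⟨hrt, rfl, rfl, rfl⟩⟩

/-- If the parser does not reject at once, then the stack is a viable prefix followed by the
lookahead. -/
theorem viableFollowedBy_of_returnsFrom {c : ParserState G.M.Γ₂ T ν} {γ : List (Symbol T ν)} {a : T}
    {rest : List T} (hH : (G.withCFG c.cfg).IsTLR eof) (hs : IsStack eof c.cfg γ c.stack)
    (hi : c.input = a :: rest) (h : G.ReturnsFrom eof c true) : c.cfg.ViableFollowedBy eof γ a := by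
  refine viableFollowedBy_of_action_ne_error hH.1 hH.2.1 fun he => ?_
  change c.cfg.action (c.cfg.stateOf eof γ) a = .error at he
  have h1 : G.parserStep eof c = .inr false := by
    rw [parserStep_eq hs hi]
    simp only [he]
  exact absurd (h.unique ⟨c, .refl, h1⟩) (by simp)

/-- An accepting run yields a chain of valid semiparses: here `α` is the string on the stack right
after the last transformation, and the run from one transformation to the next is one semiparse.
The chain is built from the end of the run, because the step after a transformation shows that in
the new grammar the stack is followed by the lookahead. -/
theorem transGen_of_returnsFrom {c d : ParserState G.M.Γ₂ T ν}
    (hcd : Relation.ReflTransGen (G.Next eof) c d) (hd : G.parserStep eof d = .inr true) :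
    ∀ (α γ : List (Symbol T ν)) (z : List T), (G.withCFG c.cfg).IsTLR eof → eof ∉ z →
      c.input = z ++ [eof] → IsStack eof c.cfg γ c.stack →
      (G.withCFG c.cfg).NontransDerives γ (α ++ c.shifted.map Symbol.terminal) →
      ∃ w H, Relation.TransGen (G.ValidSemiparse eof) ⟨α, c.shifted ++ z, c.memory, c.cfg⟩
        ⟨[Symbol.nonterminal c.cfg.start], [], w, H⟩ := by
  induction hcd using Relation.ReflTransGen.head_induction_on with
  | refl =>
    intro α γ z hH hz hi hs hn
    obtain ⟨rest, hr⟩ := append_eof_eq (eof := eof) z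
    rw [parserStep_eq hs (hi.trans hr)] at hd
    rcases hact : d.cfg.action (d.cfg.stateOf eof γ) (z.headD eof) with _ | r | _ | _ <;>
      simp only [hact] at hd
    · split at hd <;> simp at hd
    · split at hd <;> simp at hd
    · obtain ⟨rfl, h2⟩ := (action_eq_accept_iff hH.1).1 hact
      obtain rfl : z = [] := by
        cases z with
        | nil => rfl
        | cons b z => simp_all
      refine ⟨[], d.cfg, .single ?_⟩
      rw [List.append_nil]
      exact .final α d.shifted d.memory [] d.cfg hH hn
    · simp at hd
  | @head c c' hc hc' ih =>
    intro α γ z hH hz hi hs hn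
    obtain ⟨rest, hr⟩ := append_eof_eq (eof := eof) z
    rw [Next, parserStep_eq hs (hi.trans hr)] at hc
    rcases hact : c.cfg.action (c.cfg.stateOf eof γ) (z.headD eof) with _ | r | _ | _ <;>
      simp only [hact] at hc
    · split at hc
      · rename_i σ hσ
        obtain rfl := Sum.inl.inj hc
        -- the end marker is not shifted
        cases z with
        | nil =>
          obtain ⟨i, hi, β, hβ⟩ := action_eq_shift_iff.1 hact
          obtain ⟨α, w, rfl, -, h⟩ := ItemReach.lastStep hi
          exact absurd h.rightDerives fun h => hH.1.eof_notMem h (by simp [hβ])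
        | cons b z =>
          obtain rfl : z ++ [eof] = rest := by simpa using hr
          obtain ⟨w, H, h1⟩ := ih α (γ ++ [Symbol.terminal b]) z hH
            (fun h => hz (List.mem_cons_of_mem _ h)) rfl (hs.of_pushSymbol hσ)
            (by simpa [NontransDerives] using RightDerives.append_right hn [b])
          exact ⟨w, H, by simpa using h1⟩
      · simp at hc
    · obtain ⟨β', v, rfl, -, hl⟩ := lastStep_of_action_eq_reduce hact
      split at hc
      · rename_i c'' hred
        obtain rfl := Sum.inl.inj hc
        obtain ⟨h1, h2, ⟨hrt, h3, h4, h5⟩ | ⟨hrt, h3, Δ, h4, ho, hv, hΔ⟩⟩ :=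
          reduceStep_eq_some hs hred
        · rw [h3] at h1
          have := ih α (β' ++ [Symbol.nonterminal r.input]) z (h3 ▸ hH) hz (h2.trans hi) (h3 ▸ h1)
            (by
              rw [h3, h4]
              refine RightDerives.trans ?_ hn
              change RightDerives {r | r ∈ c.cfg.rules ∧ r ∉ G.trans} _ _
              simpa using RightDerives.rule (R := {r | r ∈ c.cfg.rules ∧ r ∉ G.trans})
                ⟨hl.mem_rules, hrt⟩ β' [])
          simpa only [h3, h4, h5] using this
        · have hH' : (G.withCFG c''.cfg).IsTLR eof := h4 ▸ hΔ
          obtain ⟨w, H, h5⟩ := ih (β' ++ [Symbol.nonterminal r.input])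
            (β' ++ [Symbol.nonterminal r.input]) z hH' hz (h2.trans hi) h1
            (by rw [h3, List.map_nil, List.append_nil]; exact .refl)
          have h6 := viableFollowedBy_of_returnsFrom hH' h1 (h2.trans (hi.trans hr)) ⟨d, hc', hd⟩
          rw [h3, h4] at h5
          rw [h4] at h6
          refine ⟨w, H, .head ?_ h5⟩
          refine .transform α β' r c.shifted z c.memory c''.memory c.cfg Δ hH hΔ hl.mem_rules hrt ?_
            h6 ho hv
          simpa [NontransDerives] using RightDerives.append_right hn z
      · simp at hc
    · simp at hc
    · simp at hc

/-! ### The parser halts -/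

/-- Every run of the parser ends: the length of the input never grows, and between two shifts every
reduction, transformative or not, lowers the number of pending reductions. -/
theorem exists_returnsFrom (l : ℕ) : ∀ (c : ParserState G.M.Γ₂ T ν) (γ : List (Symbol T ν)),
    c.input.length = l → (G.withCFG c.cfg).IsTLR eof → IsStack eof c.cfg γ c.stack →
    ∃ e, G.ReturnsFrom eof c e := by
  induction l with
  | zero =>
    intro c γ hl hH hs
    obtain ⟨H, σ, i, y, u⟩ := c
    obtain rfl : i = [] := List.length_eq_zero_iff.1 hl
    exact ⟨false, _, .refl, by cases σ <;> rfl⟩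
  | succ l ihl =>
    -- a step that neither ends the run nor shifts lowers the number of pending reductions
    have step (c : ParserState G.M.Γ₂ T ν) (γ : List (Symbol T ν)) (a : T) (rest : List T)
        (hi : c.input = a :: rest) (hl : rest.length = l) (hH : (G.withCFG c.cfg).IsTLR eof)
        (hs : IsStack eof c.cfg γ c.stack) : (∃ e, G.ReturnsFrom eof c e) ∨
        ∃ c' γ' n, G.Next eof c c' ∧ c'.input = a :: rest ∧ (G.withCFG c'.cfg).IsTLR eof ∧
          IsStack eof c'.cfg γ' c'.stack ∧ Pending eof c.cfg a γ (n + 1) ∧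
          Pending eof c'.cfg a γ' n := by
      rcases hstep : G.parserStep eof c with c' | e
      swap
      · exact .inl ⟨e, c, .refl, hstep⟩
      have hnext : G.Next eof c c' := hstep
      rw [parserStep_eq hs hi] at hstep
      rcases hact : c.cfg.action (c.cfg.stateOf eof γ) a with _ | r | _ | _ <;>
        simp only [hact] at hstep
      · split at hstep
        · rename_i σ hσ
          obtain ⟨e, he⟩ := ihl c' (γ ++ [Symbol.terminal a]) (by simp [← Sum.inl.inj hstep, hl])
            (by simpa [← Sum.inl.inj hstep] using hH)
            (by simpa [← Sum.inl.inj hstep] using hs.of_pushSymbol hσ)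
          exact .inl ⟨e, .head (.single hnext) he⟩
        · simp at hstep
      · obtain ⟨α, w, rfl, rfl, hlast⟩ := lastStep_of_action_eq_reduce hact
        obtain ⟨-, -, -, -, hd⟩ := lastStep_some hlast
        split at hstep
        · rename_i c'' hred
          obtain rfl := Sum.inl.inj hstep
          obtain ⟨n, hn, hnΔ⟩ := exists_pending (eof := eof) hH.2.1 hd
          have hn' := Pending.reduce α r n hlast.mem_rules hn
          obtain ⟨h1, h2, ⟨-, h3, -, -⟩ | ⟨-, -, Δ, h4, -, hv, hΔ⟩⟩ := reduceStep_eq_some hs hred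
          · exact .inr ⟨c'', _, n, hnext, h2.trans hi, h3 ▸ hH, h1, hn', h3 ▸ hn⟩
          · exact .inr ⟨c'', _, n, hnext, h2.trans hi, h4 ▸ hΔ, h1, hn', h4 ▸ hnΔ Δ hΔ.2.1 hv⟩
        · simp at hstep
      · simp at hstep
      · simp at hstep
    have loop (n : ℕ) : ∀ (c : ParserState G.M.Γ₂ T ν) (γ : List (Symbol T ν)) (a : T)
        (rest : List T), c.input = a :: rest → rest.length = l → (G.withCFG c.cfg).IsTLR eof →
        IsStack eof c.cfg γ c.stack → Pending eof c.cfg a γ n → ∃ e, G.ReturnsFrom eof c e := by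
      induction n with
      | zero =>
        intro c γ a rest hi hl hH hs hp
        obtain he | ⟨c', γ', n, -, -, -, -, h1, -⟩ := step c γ a rest hi hl hH hs
        · exact he
        · exact absurd (hp.unique hH.2.2.1 hH.1 hH.2.1 h1) (by simp)
      | succ n ih =>
        intro c γ a rest hi hl hH hs hp
        obtain he | ⟨c', γ', m, h1, h2, h3, h4, h5, h6⟩ := step c γ a rest hi hl hH hs
        · exact he
        · obtain rfl : n = m := Nat.succ.inj (hp.unique hH.2.2.1 hH.1 hH.2.1 h5)
          obtain ⟨e, he⟩ := ih c' γ' a rest h2 hl h3 h4 h6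
          exact ⟨e, .head (.single h1) he⟩
    intro c γ hl hH hs
    obtain ⟨a, rest, hi⟩ := List.exists_cons_of_length_eq_add_one hl
    have hl' : rest.length = l := by simpa [hi] using hl
    obtain he | ⟨c', γ', n, h1, h2, h3, h4, -, h6⟩ := step c γ a rest hi hl' hH hs
    · exact he
    · obtain ⟨e, he⟩ := loop n c' γ' a rest h2 hl' h3 h4 h6
      exact ⟨e, .head (.single h1) he⟩

end Grammar

end TLR

theorem mainTheorem1 {T ν C : Type*} (eof : T) (E : TLR.Coding T ν C) (G : TLR.Grammar E)
    (hG : G.IsTLR eof) (x : List T) (hx : eof ∉ x) :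
    (G.ParserReturns eof x true ↔ x ∈ G.language eof) ∧
      (G.ParserReturns eof x false ↔ x ∉ G.language eof) := by
  have hacc : G.ParserReturns eof x true ↔ x ∈ G.language eof := by
    constructor
    · rintro ⟨c, hc, hacc⟩
      exact TLR.Grammar.transGen_of_returnsFrom hc hacc [] [] x hG hx rfl .initial .refl
    · rintro ⟨w, H, h⟩
      exact TLR.Grammar.returnsFrom_of_transGen h rfl rfl (.inl rfl) rfl .initial
  refine ⟨hacc, fun h h' => ?_, fun h => ?_⟩
  · exact Bool.noConfusion (TLR.Grammar.ReturnsFrom.unique h (hacc.2 h'))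
  · obtain ⟨e, he⟩ := TLR.Grammar.exists_returnsFrom (G := G) (eof := eof) _
      ⟨G.cfg, TLR.Stack.initial eof G.cfg, x ++ [eof], [], []⟩ [] rfl hG .initial
    cases e with
    | false => exact he
    | true => exact absurd (hacc.1 he) h
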